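/- Let $m$ be a positive integer. A lazy $m$-shelf shuffle of a deck of $n$ cards, labeled $1,\dots,n$ from top to bottom, is performed on shelves numbered $0,1,\dots,m$, initially empty. The cards are dealt one at a time from the top of the deck, in the order $1,2,\dots,n$. Each card, independently and uniformly at random, receives one of $2m+1$ placements: at the bottom of shelf $0$, or, for some $s\in\{1,\dots,m\}$, on top of, or at the bottom of, the cards already on shelf $s$. The deck is then reassembled by putting the cards of shelf $0$ on top, followed by those of shelf $1$, and so on, down to shelf $m$. For $\pi\in S_n$ let $x_m(\pi)$ be the probability that the resulting deck reads $\pi(1),\dots,\pi(n)$ from top to bottom, and let $N_i(\pi)$ be the number of $i$-cycles of $\pi$ (so $N_1(\pi)$ is the number of fixed points). For $i\ge 1$ put $$ f_{i,m} = \frac{1}{2i} \sum_{\substack{d\mid i\\ d\ \mathrm{odd}}} \mu(d)\left[(2m+1)^{i/d}-1\right], $$ where $\mu$ is the Möbius function. Then every $f_{i,m}$ is a nonnegative integer, and, as formal power series in $u$ whose coefficients are polynomials over $\mathbb{Q}$ in the indeterminates $z_1,z_2,\dots$, $$ 1+\sum_{n\ge 1}u^n\sum_{\pi\in S_n}x_m(\pi)\prod_{i\ge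 1}z_i^{N_i(\pi)} = \frac{1}{1-z_1u/(2m+1)}\ \prod_{i\ge 1}\left(\frac{1+z_iu^i/(2m+1)^i}{1-z_iu^i/(2m+1)^i}\right)^{f_{i,m}}, $$ where the infinite product converges coefficientwise in $u$. -/

import Mathlib

/-- A placement instruction of the lazy shelf shuffler with `m` ordinary shelves: `none` is the lazy
shelf (bottom only); `some (s, true)` and `some (s, false)` are the top and the bottom of the
ordinary shelf number `s + 1`. There are `2 * m + 1` instructions. -/
abbrev ShelfPlacement (m : ℕ) : Type := Option (Fin m × Bool)

/-- Place the card `c`. The state lists, for each of the shelves `0, 1, …, m` (shelf `0` being the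
lazy one), the cards on that shelf from top to bottom. -/
def placeCard {m n : ℕ} (S : Fin (m + 1) → List (Fin n)) (c : Fin n) :
    ShelfPlacement m → (Fin (m + 1) → List (Fin n))
  | none => Function.update S 0 (S 0 ++ [c])
  | some (s, true) => Function.update S s.succ (c :: S s.succ)
  | some (s, false) => Function.update S s.succ (S s.succ ++ [c])

/-- The shelves after the cards have been dealt one at a time from the top of the deck
(in the order `0, 1, …, n - 1`), card `c` being placed according to `w c`. -/
def lazyShelves {m n : ℕ} (w : Fin n → ShelfPlacement m) : Fin (m + 1) → List (Fin n) :=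
  (List.finRange n).foldl (fun S c => placeCard S c (w c)) (fun _ => [])

/-- The reassembled deck, from top to bottom: shelf `0`, then shelf `1`, …, then shelf `m`. -/
def lazyDeck {m n : ℕ} (w : Fin n → ShelfPlacement m) : List (Fin n) :=
  (List.ofFn (lazyShelves w)).flatten

/-- The probability `x_m(π)` that a lazy `m`-shelf shuffle of `n` cards produces `π`, i.e. that the
resulting deck reads `π(1), …, π(n)` from top to bottom; the `(2m+1)^n` sequences of placements
are equally likely. -/
def lazyShelfProb (m : ℕ) {n : ℕ} (π : Equiv.Perm (Fin n)) : ℚ :=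
  ((Finset.univ.filter fun w : Fin n → ShelfPlacement m => lazyDeck w = List.ofFn π).card : ℚ)
    / (2 * (m : ℚ) + 1) ^ n

/-- The number `N_i(π)` of `i`-cycles of `π`; fixed points count as `1`-cycles. -/
def numCycles {n : ℕ} (i : ℕ) (π : Equiv.Perm (Fin n)) : ℕ :=
  π.partition.parts.count i

/-- The rational number `f_{i,m} = (1 / 2i) ∑_{d ∣ i, d odd} μ(d) ((2m+1)^{i/d} - 1)`. -/
def cycleExponent (i m : ℕ) : ℚ :=
  1 / (2 * (i : ℚ)) * ∑ d ∈ i.divisors.filter (fun d => Odd d),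
    (ArithmeticFunction.moebius d : ℚ) * ((2 * (m : ℚ) + 1) ^ (i / d) - 1)

/-- The generating function `1 + ∑_{n ≥ 1} u^n ∑_{π ∈ S_n} x_m(π) ∏_{i ≥ 1} z_i^{N_i(π)}`, as a
formal power series in `u` over the polynomials in the indeterminates `z_i`
(a permutation of `n` letters has no cycles longer than `n`). -/
noncomputable def lazyCycleGF (m : ℕ) : PowerSeries (MvPolynomial ℕ ℚ) :=
  PowerSeries.mk fun n => if n = 0 then 1 else
    ∑ π : Equiv.Perm (Fin n), MvPolynomial.C (lazyShelfProb m π) *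
      ∏ i ∈ Finset.Icc 1 n, MvPolynomial.X i ^ numCycles i π

/-- The series `z_i u^i / (2m+1)^i`. -/
noncomputable def cycleTerm (m i : ℕ) : PowerSeries (MvPolynomial ℕ ℚ) :=
  PowerSeries.monomial i (MvPolynomial.C (1 / (2 * (m : ℚ) + 1) ^ i) * MvPolynomial.X i)

/-- The reciprocal `1 / (1 - z_i u^i / (2m+1)^i)` for `i ≥ 1`; the denominator has constant
term `1`. -/
noncomputable def cycleGeom (m i : ℕ) : PowerSeries (MvPolynomial ℕ ℚ) :=
  PowerSeries.invOfUnit (1 - cycleTerm m i) 1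

/-! The argument is a signed version of the Gessel–Reutenauer bijection. A placement sequence `w`
produces `π` exactly when the labels `w (π p)` weakly increase with the position `p` in the reading
order of the piles, and `π` increases on each block of positions with a fixed label of sign `1` and
decreases on each block with a label of sign `-1` (`lazyDeck_eq_ofFn_iff`). So `π` behaves like a
piecewise monotone map, and each point has an itinerary of labels, periodic under `π`. In the
lexicographic order that reverses after a prefix of sign `-1`, itineraries increase weakly with the
point. Hence the pair `(π, w)` is determined by how often each circular word occurs, and every
rotation-invariant choice of multiplicities with total `n` occurs (`orbitMult_injective`,
`exists_orbitMult_eq`).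

Cycle types are visible in these data. If `x` has period `d` and multiplicity `k`, then `π ^ d` acts
on the `k` points with itinerary `x`. It is the identity if the sign over a period is `1`, and the
order reversal if it is `-1`. The orbit of `x` thus contributes `k` cycles of length `d`, or else `k
% 2` of length `d` and `k / 2` of length `2 * d`. Its generating factor is `1 / (1 - z_d u^d)` or
`(1 + z_d u^d) / (1 - z_{2d} u^{2d})`.

The alphabet has one more positive letter than negative ones, so the signs of all words of length
`i` sum to `1`. Counting then shows that the denominators with index `i` are as many as the negative
orbits of length `i`, with one extra at `i = 1` (`orbitCount_one_add`), and Möbius inversion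
identifies the number of negative orbits with `f_{i,m}` (`orbitCount_neg_one`).

For each coefficient `u^n` all words are taken of the single length `L = n!`, and the product over
orbits is compared modulo `u^(n+1)`. -/

/-! ### The deck as a sorted list -/

/-- The rank of a placement in the reading order of the piles: the lazy shelf, then for each shelf
its top pile followed by its bottom pile. -/
def placementCode {m : ℕ} : ShelfPlacement m → ℤ
  | none => 0
  | some (s, true) => 2 * s + 1
  | some (s, false) => 2 * s + 2

/-- The sign of a placement: `-1` if the pile is read in the reverse of the dealing order. -/
def placementSign {m : ℕ} : ShelfPlacement m → ℤ
  | some (_, true) => -1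
  | _ => 1

theorem placementCode_injective {m : ℕ} : Function.Injective (placementCode (m := m)) := by
  rintro (_ | ⟨s, _ | _⟩) (_ | ⟨t, _ | _⟩) h <;> simp only [placementCode] at h <;>
    first | rfl | (exfalso; omega) | (have : s = t := by ext; omega
                                      rw [this])

theorem placementSign_eq {m : ℕ} (a : ShelfPlacement m) :
    placementSign a = 1 ∨ placementSign a = -1 := by
  rcases a with (_ | ⟨s, _ | _⟩) <;> simp [placementSign]

/-- Card `c` ends up above card `d` when the cards are placed according to `w`. -/
def EndsAbove {m n : ℕ} (w : Fin n → ShelfPlacement m) (c d : Fin n) : Prop :=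
  placementCode (w c) < placementCode (w d) ∨
    (w c = w d ∧ placementSign (w c) * (c : ℤ) < placementSign (w c) * (d : ℤ))

theorem EndsAbove.asymm {m n : ℕ} {w : Fin n → ShelfPlacement m} {c d : Fin n}
    (h : EndsAbove w c d) (h' : EndsAbove w d c) : False := by
  rcases h with h | ⟨h, h2⟩ <;> rcases h' with h' | ⟨h', h2'⟩
  · omega
  · rw [h'] at h; omega
  · rw [h] at h'; omega
  · rw [h'] at h2'; omega

theorem foldl_placeCard_zero {m n : ℕ} (w : Fin n → ShelfPlacement m) (l : List (Fin n)) :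
    l.foldl (fun S c => placeCard S c (w c)) (fun _ => []) 0 = l.filter (fun c => w c = none) := by
  induction l using List.reverseRecOn with
  | nil => rfl
  | append_singleton l c ih =>
    rw [List.foldl_append, List.filter_append, ← ih]
    rcases h : w c with (_ | ⟨s, _ | _⟩) <;>
      simp [placeCard, h, Function.update_of_ne (Fin.succ_ne_zero _).symm]

theorem foldl_placeCard_succ {m n : ℕ} (w : Fin n → ShelfPlacement m) (l : List (Fin n))
    (s : Fin m) :
    l.foldl (fun S c => placeCard S c (w c)) (fun _ => []) s.succ =
      (l.filter (fun c => w c = some (s, true))).reverse ++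
        l.filter (fun c => w c = some (s, false)) := by
  induction l using List.reverseRecOn with
  | nil => rfl
  | append_singleton l c ih =>
    rw [List.foldl_append, List.filter_append, List.filter_append, List.reverse_append]
    simp only [List.foldl_cons, List.foldl_nil]
    generalize l.foldl (fun S c => placeCard S c (w c)) (fun _ => []) = S at ih ⊢
    rcases h : w c with (_ | ⟨t, _ | _⟩)
    · simp [placeCard, h, ih]
    · by_cases hst : s = t
      · subst hst; simp [placeCard, h, ih]
      · simp [placeCard, h, ih, hst, Ne.symm hst, Function.update_of_ne]
    · by_cases hst : s = t
      · subst hst; simp [placeCard, h, ih]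
      · simp [placeCard, h, ih, hst, Ne.symm hst, Function.update_of_ne]

theorem lazyShelves_zero {m n : ℕ} (w : Fin n → ShelfPlacement m) :
    lazyShelves w 0 = (List.finRange n).filter (fun c => w c = none) :=
  foldl_placeCard_zero w _

theorem lazyShelves_succ {m n : ℕ} (w : Fin n → ShelfPlacement m) (s : Fin m) :
    lazyShelves w s.succ =
      ((List.finRange n).filter (fun c => w c = some (s, true))).reverse ++
        (List.finRange n).filter (fun c => w c = some (s, false)) :=
  foldl_placeCard_succ w _ s

theorem mem_lazyDeck {m n : ℕ} (w : Fin n → ShelfPlacement m) (c : Fin n) : c ∈ lazyDeck w := by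
  simp only [lazyDeck, List.mem_flatten, List.mem_ofFn]
  rcases h : w c with (_ | ⟨s, _ | _⟩)
  · exact ⟨_, ⟨0, rfl⟩, by simp [lazyShelves_zero, h]⟩
  · exact ⟨_, ⟨s.succ, rfl⟩, by simp [lazyShelves_succ, h]⟩
  · exact ⟨_, ⟨s.succ, rfl⟩, by simp [lazyShelves_succ, h]⟩

theorem mem_lazyShelves_succ {m n : ℕ} {w : Fin n → ShelfPlacement m} {s : Fin m} {c : Fin n}
    (h : c ∈ lazyShelves w s.succ) : w c = some (s, true) ∨ w c = some (s, false) := by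
  simpa [lazyShelves_succ] using h

theorem pairwise_lazyDeck {m n : ℕ} (w : Fin n → ShelfPlacement m) :
    (lazyDeck w).Pairwise (EndsAbove w) := by
  have hlt : (List.finRange n).Pairwise (· < ·) := List.pairwise_lt_finRange n
  rw [lazyDeck, List.pairwise_flatten]
  constructor
  · intro l hl
    obtain ⟨s, rfl⟩ := List.mem_ofFn.1 hl
    cases s using Fin.cases with
    | zero =>
      rw [lazyShelves_zero, List.pairwise_filter]
      refine hlt.imp fun {a b} hab h1 h2 => Or.inr ?_
      simp only [decide_eq_true_eq] at h1 h2
      simp [h1, h2, placementSign, hab]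
    | succ s =>
      rw [lazyShelves_succ, List.pairwise_append, List.pairwise_reverse, List.pairwise_filter,
        List.pairwise_filter]
      refine ⟨hlt.imp fun {a b} hab h1 h2 => Or.inr ?_, hlt.imp fun {a b} hab h1 h2 => Or.inr ?_,
        fun a ha b hb => Or.inl ?_⟩
      · simp only [decide_eq_true_eq] at h1 h2
        simp [h1, h2, placementSign, hab]
      · simp only [decide_eq_true_eq] at h1 h2
        simp [h1, h2, placementSign, hab]
      · simp only [List.mem_reverse, List.mem_filter, List.mem_finRange, decide_eq_true_eq,
          true_and] at ha hb
        rw [ha, hb]; simp [placementCode]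
  · rw [List.pairwise_ofFn]
    intro i j hij a ha b hb
    left
    cases j using Fin.cases with
    | zero => exact absurd hij (Fin.not_lt_zero i)
    | succ t =>
      cases i using Fin.cases with
      | zero =>
        have ha' : w a = none := by simpa [lazyShelves_zero] using ha
        rcases mem_lazyShelves_succ hb with hb | hb <;> rw [ha', hb] <;> simp [placementCode] <;>
          omega
      | succ s =>
        have hst : (s : ℤ) < t := by exact_mod_cast Fin.succ_lt_succ_iff.1 hij
        rcases mem_lazyShelves_succ ha with ha | ha <;>
        rcases mem_lazyShelves_succ hb with hb | hb <;> rw [ha, hb] <;> simp [placementCode] <;>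
          omega

theorem EndsAbove.irrefl {m n : ℕ} {w : Fin n → ShelfPlacement m} {c : Fin n} :
    ¬ EndsAbove w c c := fun h => h.asymm h

/-- Both lists contain each card once, and `EndsAbove w` is asymmetric, so at most one arrangement
of the cards is sorted by it. -/
theorem lazyDeck_eq_ofFn_iff {m n : ℕ} (w : Fin n → ShelfPlacement m) (π : Equiv.Perm (Fin n)) :
    lazyDeck w = List.ofFn π ↔ ∀ i j, i < j → EndsAbove w (π i) (π j) := by
  constructor
  · intro h
    have := pairwise_lazyDeck w
    rw [h, List.pairwise_ofFn] at this
    exact fun i j hij => this hij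
  · intro h
    refine List.Perm.eq_of_pairwise (le := EndsAbove w) (fun a b _ _ h1 h2 => (h1.asymm h2).elim)
      (pairwise_lazyDeck w) (List.pairwise_ofFn.2 fun i j hij => h i j hij) ?_
    refine (List.perm_ext_iff_of_nodup ?_ ?_).2 fun c => ?_
    · exact (pairwise_lazyDeck w).imp fun {a b} hab (hne : a = b) => EndsAbove.irrefl (hne ▸ hab)
    · exact List.nodup_ofFn.2 π.injective
    · simp only [mem_lazyDeck, List.mem_ofFn, true_iff]
      exact ⟨π.symm c, by simp⟩

/-! ### Orbits of a permutation of a finite type -/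

/-- The orbits of the permutation `T`. -/
abbrev PermOrbit {X : Type*} (T : Equiv.Perm X) : Type _ :=
  MulAction.orbitRel.Quotient (Subgroup.zpowers T) X

/-- The orbit of `x` under `T`. -/
abbrev permOrbitMk {X : Type*} (T : Equiv.Perm X) (x : X) : PermOrbit T :=
  Quotient.mk'' x

theorem permOrbitMk_eq_iff {X : Type*} (T : Equiv.Perm X) {x y : X} :
    permOrbitMk T y = permOrbitMk T x ↔ y ∈ MulAction.orbit (Subgroup.zpowers T) x := by
  rw [permOrbitMk, permOrbitMk, Quotient.eq'', MulAction.orbitRel_apply]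

theorem permOrbitMk_apply {X : Type*} (T : Equiv.Perm X) (x : X) :
    permOrbitMk T (T x) = permOrbitMk T x :=
  (permOrbitMk_eq_iff T).2 ⟨⟨T, Subgroup.mem_zpowers T⟩, rfl⟩

theorem eq_of_permOrbitMk_eq {X β : Type*} {T : Equiv.Perm X} {g : X → β}
    (hg : ∀ x, g (T x) = g x) {x y : X} (h : permOrbitMk T y = permOrbitMk T x) : g y = g x := by
  obtain ⟨⟨_, ⟨k, rfl⟩⟩, rfl⟩ := (permOrbitMk_eq_iff T).1 h
  change g ((T ^ k) x) = g x
  have hinv : ∀ x, g (T⁻¹ x) = g x := fun x => by rw [← hg (T⁻¹ x)]; simp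
  induction k using Int.induction_on with
  | zero => simp
  | succ i ih =>
    rw [add_comm, zpow_add, zpow_one, Equiv.Perm.mul_apply, hg]
    exact ih ((permOrbitMk_eq_iff T).2 ⟨⟨_, ⟨i, rfl⟩⟩, rfl⟩)
  | pred i ih =>
    rw [sub_eq_add_neg, add_comm, zpow_add, zpow_neg_one, Equiv.Perm.mul_apply, hinv]
    exact ih ((permOrbitMk_eq_iff T).2 ⟨⟨_, ⟨-i, rfl⟩⟩, rfl⟩)

theorem card_permOrbitMk_eq {X : Type*} [Fintype X] [DecidableEq X] (T : Equiv.Perm X)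
    [DecidableEq (PermOrbit T)] (x : X) :
    (Finset.univ.filter fun y => permOrbitMk T y = permOrbitMk T x).card =
      Function.minimalPeriod T x := by
  classical
  have := MulAction.minimalPeriod_eq_card (a := T) (b := x)
  rw [show (fun y => T • y) = T from rfl] at this
  rw [this, Fintype.card_subtype]
  congr 1
  ext y
  simp only [Finset.mem_filter, Finset.mem_univ, true_and]
  exact permOrbitMk_eq_iff T

/-! ### Circular words -/

/-- Words indexed by `ZMod L`. -/
def CircWord (L m : ℕ) : Type := ZMod L → ShelfPlacement m

instance (L m : ℕ) [NeZero L] : Fintype (CircWord L m) :=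
  inferInstanceAs (Fintype (ZMod L → ShelfPlacement m))

instance (L m : ℕ) [NeZero L] : DecidableEq (CircWord L m) :=
  inferInstanceAs (DecidableEq (ZMod L → ShelfPlacement m))

/-- The left rotation of circular words. -/
def rotateWord (L m : ℕ) : Equiv.Perm (CircWord L m) where
  toFun x := fun i => x (i + 1)
  invFun x := fun i => x (i - 1)
  left_inv x := by funext i; simp
  right_inv x := by funext i; simp

theorem rotateWord_apply {L m : ℕ} (x : CircWord L m) (i : ZMod L) :
    rotateWord L m x i = x (i + 1) := rfl

theorem rotateWord_iterate {L m : ℕ} (x : CircWord L m) (k : ℕ) (i : ZMod L) :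
    (rotateWord L m)^[k] x i = x (i + k) := by
  induction k generalizing x with
  | zero => simp
  | succ k ih => rw [Function.iterate_succ_apply, ih, rotateWord_apply]; push_cast; congr 1; ring

/-- The product of the signs of the first `k` letters. -/
def prefixSign {L m : ℕ} (x : CircWord L m) (k : ℕ) : ℤ :=
  ∏ j ∈ Finset.range k, placementSign (x (j : ZMod L))

theorem prefixSign_eq {L m : ℕ} (x : CircWord L m) (k : ℕ) :
    prefixSign x k = 1 ∨ prefixSign x k = -1 := by
  induction k with
  | zero => simp [prefixSign]
  | succ k ih =>
    rw [prefixSign, Finset.prod_range_succ, ← prefixSign]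
    rcases ih with h | h <;> rcases placementSign_eq (x (k : ZMod L)) with h' | h' <;> simp [h, h']

theorem prefixSign_succ {L m : ℕ} (x : CircWord L m) (k : ℕ) :
    prefixSign x (k + 1) = placementSign (x 0) * prefixSign (rotateWord L m x) k := by
  rw [prefixSign, Finset.prod_range_succ', mul_comm]
  simp [prefixSign, rotateWord_apply]

/-- Peeling the first or the last letter off the prefix of length `d + 1` leaves the two sides, and
these letters agree by periodicity. This makes the sign of an orbit well defined. -/
theorem prefixSign_rotate {L m : ℕ} (x : CircWord L m) {d : ℕ}
    (h : Function.IsPeriodicPt (rotateWord L m) d x) :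
    prefixSign (rotateWord L m x) d = prefixSign x d := by
  have h0 : x (d : ZMod L) = x 0 := by
    have := congrFun h.eq 0
    rwa [rotateWord_iterate, zero_add] at this
  have h1 := prefixSign_succ x d
  rw [prefixSign, Finset.prod_range_succ, ← prefixSign, h0, mul_comm] at h1
  rcases placementSign_eq (x 0) with h' | h' <;> rw [h'] at h1 <;> linarith

/-- The signed letters of a circular word; words are compared by the lexicographic order of
these. -/
def wordKey {L m : ℕ} (x : CircWord L m) : Lex (ℕ → ℤ) :=
  toLex fun k => prefixSign x k * placementCode (x (k : ZMod L))

/-- Letters are decoded one by one: the earlier letters fix the prefix sign, which then cancels. -/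
theorem wordKey_injective {L m : ℕ} [NeZero L] : Function.Injective (wordKey (L := L) (m := m)) := by
  intro x y h
  have key : ∀ k : ℕ, x (k : ZMod L) = y (k : ZMod L) := by
    intro k
    induction k using Nat.strong_induction_on with
    | _ k ih =>
      have hs : prefixSign x k = prefixSign y k :=
        Finset.prod_congr rfl fun j hj => by rw [ih j (Finset.mem_range.1 hj)]
      have hk : prefixSign x k * placementCode (x (k : ZMod L)) =
          prefixSign y k * placementCode (y (k : ZMod L)) := congrFun h k
      rw [hs] at hk
      apply placementCode_injective
      rcases prefixSign_eq y k with h' | h' <;> rw [h'] at hk <;> linarith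
  funext i
  simpa using key i.val

noncomputable instance (L m : ℕ) [NeZero L] : LinearOrder (CircWord L m) :=
  LinearOrder.lift' wordKey wordKey_injective

/-- Up to the first disagreement the two prefix signs coincide, so the sign of `x` alone suffices.
-/
theorem circWord_lt_iff {L m : ℕ} [NeZero L] {x y : CircWord L m} :
    x < y ↔ ∃ k : ℕ, (∀ j < k, x (j : ZMod L) = y (j : ZMod L)) ∧
      prefixSign x k * placementCode (x (k : ZMod L)) <
        prefixSign x k * placementCode (y (k : ZMod L)) := by
  have hs : ∀ k : ℕ, (∀ j < k, x (j : ZMod L) = y (j : ZMod L)) →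
      prefixSign x k = prefixSign y k := fun k h =>
    Finset.prod_congr rfl fun j hj => by rw [h j (Finset.mem_range.1 hj)]
  have h0 : x < y ↔ ∃ k : ℕ, (∀ j < k, prefixSign x j * placementCode (x (j : ZMod L)) =
      prefixSign y j * placementCode (y (j : ZMod L))) ∧
      prefixSign x k * placementCode (x (k : ZMod L)) <
        prefixSign y k * placementCode (y (k : ZMod L)) := Iff.rfl
  rw [h0]
  refine exists_congr fun k => ?_
  constructor
  · rintro ⟨h1, h2⟩
    have h3 : ∀ j < k, x (j : ZMod L) = y (j : ZMod L) := by
      intro j hj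
      induction j using Nat.strong_induction_on with
      | _ j ih =>
        have h4 := h1 j hj
        rw [hs j fun i hi => ih i hi (hi.trans hj)] at h4
        apply placementCode_injective
        rcases prefixSign_eq y j with h' | h' <;> rw [h'] at h4 <;> linarith
    exact ⟨h3, by rw [hs k h3] at h2 ⊢; exact h2⟩
  · rintro ⟨h1, h2⟩
    refine ⟨fun j hj => ?_, by rw [← hs k h1]; exact h2⟩
    rw [hs j fun i hi => h1 i (hi.trans hj), h1 j hj]

/-- Words with the same first letter compare as their tails do, reversed if that letter is
negative. -/
theorem circWord_lt_cases {L m : ℕ} [NeZero L] {x y : CircWord L m} (h : x < y) :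
    placementCode (x 0) < placementCode (y 0) ∨ (x 0 = y 0 ∧
      ((placementSign (x 0) = 1 ∧ rotateWord L m x < rotateWord L m y) ∨
        (placementSign (x 0) = -1 ∧ rotateWord L m y < rotateWord L m x))) := by
  obtain ⟨k, h1, h2⟩ := circWord_lt_iff.1 h
  cases k with
  | zero => left; simpa [prefixSign] using h2
  | succ k =>
    right
    have h0 : x 0 = y 0 := by simpa using h1 0 (Nat.succ_pos k)
    refine ⟨h0, ?_⟩
    have h3 : ∀ j < k, rotateWord L m x (j : ZMod L) = rotateWord L m y (j : ZMod L) := by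
      intro j hj
      simpa [rotateWord_apply] using h1 (j + 1) (Nat.succ_lt_succ hj)
    have hs : prefixSign (rotateWord L m x) k = prefixSign (rotateWord L m y) k :=
      Finset.prod_congr rfl fun j hj => by rw [h3 j (Finset.mem_range.1 hj)]
    rw [prefixSign_succ] at h2
    push_cast at h2
    rcases placementSign_eq (x 0) with h' | h'
    · refine Or.inl ⟨h', circWord_lt_iff.2 ⟨k, h3, ?_⟩⟩
      simpa [h', rotateWord_apply] using h2
    · refine Or.inr ⟨h', circWord_lt_iff.2 ⟨k, fun j hj => (h3 j hj).symm, ?_⟩⟩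
      rw [← hs]
      simpa [h', rotateWord_apply] using h2

/-! ### Itineraries -/

/-- The letters met along the orbit of `p` under `π`. -/
def itinerary {m n : ℕ} (L : ℕ) (w : Fin n → ShelfPlacement m) (π : Equiv.Perm (Fin n))
    (p : Fin n) : CircWord L m :=
  fun i => w ((π ^ (i.val + 1)) p)

section Itinerary

variable {m n L : ℕ} {w : Fin n → ShelfPlacement m} {π : Equiv.Perm (Fin n)}

theorem itinerary_natCast (hL : π ^ L = 1) (p : Fin n) (k : ℕ) :
    itinerary L w π p (k : ZMod L) = w ((π ^ (k + 1)) p) := by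
  rw [itinerary, ZMod.val_natCast, pow_succ, pow_succ, ← pow_eq_pow_mod k hL]

/-- The itinerary starts at `π p`, not at `p`, because sortedness of the deck concerns `w ∘ π` as a
function of the position. -/
theorem itinerary_zero (hL : π ^ L = 1) (p : Fin n) : itinerary L w π p 0 = w (π p) := by
  simpa using itinerary_natCast (w := w) hL p 0

theorem itinerary_apply [NeZero L] (hL : π ^ L = 1) (p : Fin n) :
    itinerary L w π (π p) = rotateWord L m (itinerary L w π p) := by
  funext i
  rw [rotateWord_apply]
  have h1 := itinerary_natCast (w := w) hL (π p) i.val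
  have h2 := itinerary_natCast (w := w) hL p (i.val + 1)
  rw [Nat.cast_add, Nat.cast_one] at h2
  rw [ZMod.natCast_zmod_val] at h1 h2
  rw [h1, h2, pow_succ π (i.val + 1), Equiv.Perm.mul_apply]

theorem itinerary_pow_apply [NeZero L] (hL : π ^ L = 1) (p : Fin n) (k : ℕ) :
    itinerary L w π ((π ^ k) p) = (rotateWord L m)^[k] (itinerary L w π p) := by
  induction k generalizing p with
  | zero => rfl
  | succ k ih =>
    rw [pow_succ, Equiv.Perm.mul_apply, ih, itinerary_apply hL, Function.iterate_succ_apply]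

/-- When the first letters agree, `π` preserves or reverses the order of `p` and `q` according to
the sign of that letter, which is the factor by which the prefix sign changes. -/
theorem itinerary_code_lt [NeZero L] (hL : π ^ L = 1)
    (hG : ∀ i j, i < j → EndsAbove w (π i) (π j)) (k : ℕ) {p q : Fin n} (hpq : p < q)
    (heq : ∀ j < k, itinerary L w π p (j : ZMod L) = itinerary L w π q (j : ZMod L))
    (hne : itinerary L w π p (k : ZMod L) ≠ itinerary L w π q (k : ZMod L)) :
    prefixSign (itinerary L w π p) k * placementCode (itinerary L w π p (k : ZMod L)) <
      prefixSign (itinerary L w π p) k * placementCode (itinerary L w π q (k : ZMod L)) := by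
  induction k generalizing p q with
  | zero =>
    rcases hG p q hpq with h | ⟨h, -⟩
    · simpa [prefixSign, itinerary_zero hL] using h
    · simp [itinerary_zero hL, h] at hne
  | succ k ih =>
    have h0 : w (π p) = w (π q) := by
      simpa [itinerary_zero hL] using heq 0 (Nat.succ_pos k)
    have hstep : ∀ (r : Fin n) (j : ℕ), itinerary L w π r ((j + 1 : ℕ) : ZMod L) =
        itinerary L w π (π r) (j : ZMod L) := fun r j => by
      rw [itinerary_apply hL, rotateWord_apply]; push_cast; rfl
    have heq' : ∀ j < k, itinerary L w π (π p) (j : ZMod L) =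
        itinerary L w π (π q) (j : ZMod L) := fun j hj => by
      rw [← hstep, ← hstep]; exact heq (j + 1) (Nat.succ_lt_succ hj)
    rw [hstep, hstep] at hne ⊢
    rw [prefixSign_succ, itinerary_zero hL, ← itinerary_apply hL]
    have hs : prefixSign (itinerary L w π (π p)) k = prefixSign (itinerary L w π (π q)) k :=
      Finset.prod_congr rfl fun j hj => by rw [heq' j (Finset.mem_range.1 hj)]
    rcases hG p q hpq with h | ⟨-, h⟩
    · rw [h0] at h; exact absurd h (lt_irrefl _)
    rcases placementSign_eq (w (π p)) with h' | h' <;> rw [h'] at h ⊢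
    · have h1 : π p < π q := by simpa using h
      simpa using ih h1 heq' hne
    · have h1 : π q < π p := by simpa using h
      -- The points have changed order, so the induction hypothesis carries the prefix sign of the
      -- itinerary of `π q`; `hs` converts it.
      have := ih h1 (fun j hj => (heq' j hj).symm) hne.symm
      rw [hs]
      linarith

theorem itinerary_lt [NeZero L] (hL : π ^ L = 1)
    (hG : ∀ i j, i < j → EndsAbove w (π i) (π j)) {p q : Fin n} (hpq : p < q)
    (hne : itinerary L w π p ≠ itinerary L w π q) :
    itinerary L w π p < itinerary L w π q := by
  have hex : ∃ k : ℕ, itinerary L w π p (k : ZMod L) ≠ itinerary L w π q (k : ZMod L) := by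
    by_contra! h
    exact hne (funext fun i => by simpa using h i.val)
  classical
  have hmin : ∀ j < Nat.find hex,
      itinerary L w π p (j : ZMod L) = itinerary L w π q (j : ZMod L) :=
    fun j hj => not_not.1 (Nat.find_min hex hj)
  exact circWord_lt_iff.2
    ⟨Nat.find hex, hmin, itinerary_code_lt hL hG _ hpq hmin (Nat.find_spec hex)⟩

theorem itinerary_monotone [NeZero L] (hL : π ^ L = 1)
    (hG : ∀ i j, i < j → EndsAbove w (π i) (π j)) : Monotone (itinerary L w π) := by
  intro p q hpq
  rcases hpq.eq_or_lt with rfl | hlt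
  · exact le_rfl
  · by_cases h : itinerary L w π p = itinerary L w π q
    · exact h.le
    · exact (itinerary_lt hL hG hlt h).le

/-- On the points with a common itinerary, the powers of `π` are monotone or antitone according to
the sign of the prefix. -/
theorem sign_mul_pow_lt [NeZero L] (hL : π ^ L = 1)
    (hG : ∀ i j, i < j → EndsAbove w (π i) (π j)) (k : ℕ) {p q : Fin n} (hpq : p < q)
    (heq : itinerary L w π p = itinerary L w π q) :
    prefixSign (itinerary L w π p) k * (((π ^ k) p : Fin n) : ℤ) <
      prefixSign (itinerary L w π p) k * (((π ^ k) q : Fin n) : ℤ) := by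
  induction k generalizing p q with
  | zero => simpa [prefixSign] using hpq
  | succ k ih =>
    have h0 : w (π p) = w (π q) := by
      rw [← itinerary_zero (w := w) hL, heq, itinerary_zero hL]
    have heq' : itinerary L w π (π p) = itinerary L w π (π q) := by
      rw [itinerary_apply hL, itinerary_apply hL, heq]
    rw [prefixSign_succ, itinerary_zero hL, ← itinerary_apply hL, pow_succ,
      Equiv.Perm.mul_apply, Equiv.Perm.mul_apply]
    rcases hG p q hpq with h | ⟨-, h⟩
    · rw [h0] at h; exact absurd h (lt_irrefl _)
    rcases placementSign_eq (w (π p)) with h' | h' <;> rw [h'] at h ⊢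
    · have h1 : π p < π q := by simpa using h
      simpa using ih h1 heq'
    · have h1 : π q < π p := by simpa using h
      have := ih h1 heq'.symm
      rw [heq']
      linarith

/-- The itineraries alone decide how `π p` and `π q` compare. If those of `p` and `q` differ, so do
those of the images, and monotonicity decides; if they agree, the sign of the common first letter
tells whether `π` keeps or reverses the order. -/
theorem perm_apply_lt_of_itinerary_eq [NeZero L] {w' : Fin n → ShelfPlacement m}
    {π' : Equiv.Perm (Fin n)} (hL : π ^ L = 1) (hL' : π' ^ L = 1)
    (hG : ∀ i j, i < j → EndsAbove w (π i) (π j))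
    (hG' : ∀ i j, i < j → EndsAbove w' (π' i) (π' j))
    (h : itinerary L w π = itinerary L w' π') {p q : Fin n} (hpq : π p < π q) :
    π' p < π' q := by
  by_cases heq : itinerary L w π p = itinerary L w π q
  · have heq' : itinerary L w' π' p = itinerary L w' π' q := by rwa [← h]
    rcases lt_trichotomy p q with hlt | rfl | hlt
    · have h1 := sign_mul_pow_lt hL hG 1 hlt heq
      have h2 := sign_mul_pow_lt hL' hG' 1 hlt heq'
      rw [← h] at h2
      have h3 : ((π p : Fin n) : ℤ) < (π q : Fin n) := by exact_mod_cast hpq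
      rcases prefixSign_eq (itinerary L w π p) 1 with h' | h' <;> rw [h'] at h1 h2
      · simpa using h2
      · simp only [pow_one] at h1; linarith
    · exact absurd hpq (lt_irrefl _)
    · have h1 := sign_mul_pow_lt hL hG 1 hlt heq.symm
      have h2 := sign_mul_pow_lt hL' hG' 1 hlt heq'.symm
      rw [← h] at h2
      have h3 : ((π p : Fin n) : ℤ) < (π q : Fin n) := by exact_mod_cast hpq
      rcases prefixSign_eq (itinerary L w π q) 1 with h' | h' <;> rw [h'] at h1 h2
      · simp only [pow_one] at h1; linarith
      · simpa using h2
  · have hne : itinerary L w π (π p) ≠ itinerary L w π (π q) := fun h1 => by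
      rw [itinerary_apply hL, itinerary_apply hL] at h1
      exact heq ((rotateWord L m).injective h1)
    have hlt := itinerary_lt hL hG hpq hne
    by_contra hle
    have h2 := itinerary_monotone hL' hG' (not_lt.1 hle)
    rw [itinerary_apply hL', itinerary_apply hL', ← h, ← itinerary_apply hL,
      ← itinerary_apply hL] at h2
    exact absurd hlt (not_lt.2 h2)

theorem eq_of_itinerary_eq [NeZero L] {w' : Fin n → ShelfPlacement m}
    {π' : Equiv.Perm (Fin n)} (hL : π ^ L = 1) (hL' : π' ^ L = 1)
    (hG : ∀ i j, i < j → EndsAbove w (π i) (π j))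
    (hG' : ∀ i j, i < j → EndsAbove w' (π' i) (π' j))
    (h : itinerary L w π = itinerary L w' π') : π = π' ∧ w = w' := by
  have hπ : π = π' := by
    have hmono : StrictMono (π.symm.trans π') := fun a b hab =>
      perm_apply_lt_of_itinerary_eq hL hL' hG hG' h (by simpa using hab)
    let e : Fin n ≃o Fin n := hmono.orderIsoOfSurjective _ (Equiv.surjective _)
    -- `Fin n` has only one order automorphism.
    have he : e = OrderIso.refl _ := Subsingleton.elim _ _
    ext p
    have := DFunLike.congr_fun he (π p)
    simpa [e] using congrArg Fin.val this.symm
  refine ⟨hπ, funext fun c => ?_⟩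
  have h0 := congrFun (congrFun h (π.symm c)) 0
  rw [itinerary_zero hL, itinerary_zero hL', ← hπ] at h0
  simpa using h0

end Itinerary

/-- Both functions list the same multiset in sorted order. -/
theorem eq_of_monotone_of_card_fiber_eq {n : ℕ} {α : Type*} [PartialOrder α] [DecidableEq α]
    {f g : Fin n → α}
    (hf : Monotone f) (hg : Monotone g)
    (h : ∀ a, (Finset.univ.filter fun p => f p = a).card =
      (Finset.univ.filter fun p => g p = a).card) : f = g := by
  refine List.ofFn_injective (List.Perm.eq_of_pairwise' hf.sortedLE_ofFn.pairwise
    hg.sortedLE_ofFn.pairwise ?_)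
  rw [List.ofFn_eq_map, List.ofFn_eq_map, ← Multiset.coe_eq_coe]
  change Multiset.map f Finset.univ.val = Multiset.map g Finset.univ.val
  ext a
  rw [Multiset.count_map, Multiset.count_map]
  have := h a
  simp only [Finset.card, Finset.filter_val] at this
  simpa only [eq_comm] using this

theorem eq_of_card_itinerary_eq {m n L : ℕ} [NeZero L] {w w' : Fin n → ShelfPlacement m}
    {π π' : Equiv.Perm (Fin n)} (hL : π ^ L = 1) (hL' : π' ^ L = 1)
    (hG : ∀ i j, i < j → EndsAbove w (π i) (π j))
    (hG' : ∀ i j, i < j → EndsAbove w' (π' i) (π' j))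
    (h : ∀ x, (Finset.univ.filter fun p => itinerary L w π p = x).card =
      (Finset.univ.filter fun p => itinerary L w' π' p = x).card) : π = π' ∧ w = w' :=
  eq_of_itinerary_eq hL hL' hG hG'
    (eq_of_monotone_of_card_fiber_eq (itinerary_monotone hL hG) (itinerary_monotone hL' hG') h)

/-! ### Realizing multiplicities of circular words -/

/-- The pairs of a word `x` and a natural number below `κ x`, ordered lexicographically. -/
abbrev WordCopies {L m : ℕ} [NeZero L] (κ : CircWord L m → ℕ) : Type :=
  {y : CircWord L m ×ₗ ℕ // (ofLex y).2 < κ (ofLex y).1}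

namespace WordCopies

variable {L m : ℕ} [NeZero L] {κ : CircWord L m → ℕ}

/-- The word of which `y` is a copy. -/
def word (y : WordCopies κ) : CircWord L m := (ofLex y.1).1

/-- The number of the copy `y`. -/
def idx (y : WordCopies κ) : ℕ := (ofLex y.1).2

theorem idx_lt (y : WordCopies κ) : y.idx < κ y.word := y.2

/-- The `j`-th copy of `x`. -/
def copy (x : CircWord L m) (j : ℕ) (h : j < κ x) : WordCopies κ := ⟨toLex (x, j), h⟩

theorem ext {y z : WordCopies κ} (h1 : y.word = z.word) (h2 : y.idx = z.idx) : y = z :=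
  Subtype.ext (Prod.ext h1 h2)

theorem lt_iff {y z : WordCopies κ} :
    y < z ↔ y.word < z.word ∨ (y.word = z.word ∧ y.idx < z.idx) :=
  Prod.Lex.lt_iff

/-- Copies as a sigma type. -/
def sigmaEquiv : (Σ x : CircWord L m, Fin (κ x)) ≃ WordCopies κ where
  toFun s := copy s.1 s.2 s.2.2
  invFun y := ⟨y.word, ⟨y.idx, y.idx_lt⟩⟩
  left_inv _ := rfl
  right_inv _ := rfl

instance : Fintype (WordCopies κ) := Fintype.ofEquiv _ sigmaEquiv

theorem card_eq : Fintype.card (WordCopies κ) = ∑ x, κ x := by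
  rw [← Fintype.card_congr (sigmaEquiv (κ := κ)), Fintype.card_sigma]
  simp

/-- Rotation of words on the copies, reversing the order of the copies of a word with negative
first letter. -/
def rotateFun (hκ : ∀ x, κ (rotateWord L m x) = κ x) (y : WordCopies κ) : WordCopies κ :=
  copy (rotateWord L m y.word)
    (if placementSign (y.word 0) = 1 then y.idx else κ y.word - 1 - y.idx) (by
      have := y.idx_lt
      rw [hκ]
      split_ifs <;> omega)

theorem rotateFun_injective (hκ : ∀ x, κ (rotateWord L m x) = κ x) :
    Function.Injective (rotateFun hκ) := by
  intro y z h
  have h1 : rotateWord L m y.word = rotateWord L m z.word := congrArg word h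
  have h2 : (if placementSign (y.word 0) = 1 then y.idx else κ y.word - 1 - y.idx) =
    (if placementSign (z.word 0) = 1 then z.idx else κ z.word - 1 - z.idx) := congrArg idx h
  have h3 := (rotateWord L m).injective h1
  refine ext h3 ?_
  have hy := y.idx_lt
  have hz := z.idx_lt
  rw [h3] at h2 hy
  split_ifs at h2 <;> omega

/-- `WordCopies.rotateFun` as a permutation. -/
noncomputable def rotate (hκ : ∀ x, κ (rotateWord L m x) = κ x) : Equiv.Perm (WordCopies κ) :=
  Equiv.ofBijective (rotateFun hκ) (Finite.injective_iff_bijective.1 (rotateFun_injective hκ))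

theorem word_rotate (hκ : ∀ x, κ (rotateWord L m x) = κ x) (y : WordCopies κ) :
    (rotate hκ y).word = rotateWord L m y.word := rfl

theorem idx_rotate (hκ : ∀ x, κ (rotateWord L m x) = κ x) (y : WordCopies κ) :
    (rotate hκ y).idx =
      if placementSign (y.word 0) = 1 then y.idx else κ y.word - 1 - y.idx := rfl

theorem word_rotate_pow (hκ : ∀ x, κ (rotateWord L m x) = κ x) (k : ℕ) (y : WordCopies κ) :
    ((rotate hκ ^ k) y).word = (rotateWord L m)^[k] y.word := by
  induction k generalizing y with
  | zero => rfl
  | succ k ih => rw [pow_succ, Equiv.Perm.mul_apply, ih, word_rotate, Function.iterate_succ_apply]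

theorem card_word_eq (x : CircWord L m) :
    (Finset.univ.filter fun y : WordCopies κ => y.word = x).card = κ x := by
  rw [← Fintype.card_fin (κ x), ← Finset.card_univ]
  symm
  refine Finset.card_bij (fun j _ => copy x j j.2)
    (fun j _ => Finset.mem_filter.2 ⟨Finset.mem_univ _, rfl⟩) ?_ ?_
  · intro i _ j _ h
    exact Fin.ext (congrArg idx h)
  · intro y hy
    obtain rfl : y.word = x := by simpa using hy
    exact ⟨⟨y.idx, y.idx_lt⟩, Finset.mem_univ _, rfl⟩

/-- The copies are sorted by the first letter and the rotation. -/
theorem rotate_lt_cases (hκ : ∀ x, κ (rotateWord L m x) = κ x) {y z : WordCopies κ}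
    (h : y < z) :
    placementCode (y.word 0) < placementCode (z.word 0) ∨ (y.word 0 = z.word 0 ∧
      ((placementSign (y.word 0) = 1 ∧ rotate hκ y < rotate hκ z) ∨
        (placementSign (y.word 0) = -1 ∧ rotate hκ z < rotate hκ y))) := by
  rcases lt_iff.1 h with h | ⟨h, h'⟩
  · rcases circWord_lt_cases h with h | ⟨h0, ⟨h1, h2⟩ | ⟨h1, h2⟩⟩
    · exact Or.inl h
    · exact Or.inr ⟨h0, Or.inl ⟨h1, lt_iff.2 (Or.inl h2)⟩⟩
    · exact Or.inr ⟨h0, Or.inr ⟨h1, lt_iff.2 (Or.inl h2)⟩⟩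
  · refine Or.inr ⟨by rw [h], ?_⟩
    have hy := y.idx_lt
    have hz := z.idx_lt
    rw [h] at hy ⊢
    rcases placementSign_eq (z.word 0) with h1 | h1
    · refine Or.inl ⟨h1, lt_iff.2 (Or.inr ⟨by rw [word_rotate, word_rotate, h], ?_⟩)⟩
      rw [idx_rotate, idx_rotate, h, if_pos h1, if_pos h1]
      exact h'
    · refine Or.inr ⟨h1, lt_iff.2 (Or.inr ⟨by rw [word_rotate, word_rotate, h], ?_⟩)⟩
      rw [idx_rotate, idx_rotate, h, if_neg (by rw [h1]; norm_num),
        if_neg (by rw [h1]; norm_num)]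
      omega

end WordCopies

/-- Surjectivity of the bijection: `π` is the rotation of word copies, transported along the order
isomorphism with `Fin n`. Reversing the copies at negative letters is what makes the deck sorted
among points with equal itineraries. -/
theorem exists_card_itinerary_eq {m n L : ℕ} [NeZero L] {κ : CircWord L m → ℕ}
    (hκ : ∀ x, κ (rotateWord L m x) = κ x) (hn : ∑ x, κ x = n) :
    ∃ (π : Equiv.Perm (Fin n)) (w : Fin n → ShelfPlacement m),
      (∀ i j, i < j → EndsAbove w (π i) (π j)) ∧
      ∀ x, (Finset.univ.filter fun p => itinerary L w π p = x).card = κ x := by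
  have hcard : Fintype.card (WordCopies κ) = n := WordCopies.card_eq.trans hn
  let e : Fin n ≃o WordCopies κ := Fintype.orderIsoFinOfCardEq _ hcard
  let π : Equiv.Perm (Fin n) := (e.toEquiv.trans (WordCopies.rotate hκ)).trans e.symm.toEquiv
  have hπ : ∀ p, e (π p) = WordCopies.rotate hκ (e p) := fun p => by simp [π]
  have hpow : ∀ (k : ℕ) p, e ((π ^ k) p) = (WordCopies.rotate hκ ^ k) (e p) := by
    intro k
    induction k with
    | zero => intro p; rfl
    | succ k ih => intro p; rw [pow_succ, pow_succ, Equiv.Perm.mul_apply, Equiv.Perm.mul_apply,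
                    ih, hπ]
  -- The inverse of `π` appears because the first letter of the itinerary of `p` must be `w (π p)`.
  let w : Fin n → ShelfPlacement m := fun c => (e (π.symm c)).word 0
  have hw : ∀ p, w (π p) = (e p).word 0 := fun p => by simp [w]
  have hit : ∀ p, itinerary L w π p = (e p).word := by
    intro p
    funext i
    rw [itinerary, pow_succ', Equiv.Perm.mul_apply, hw, hpow, WordCopies.word_rotate_pow,
      rotateWord_iterate, zero_add, ZMod.natCast_zmod_val]
  refine ⟨π, w, fun i j hij => ?_, fun x => ?_⟩
  · rw [EndsAbove, hw, hw]
    rcases WordCopies.rotate_lt_cases hκ (e.lt_iff_lt.2 hij) with h | ⟨h0, ⟨h1, h2⟩ | ⟨h1, h2⟩⟩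
    · exact Or.inl h
    · rw [← hπ, ← hπ, e.lt_iff_lt] at h2
      exact Or.inr ⟨h0, by rw [h1]; simpa using h2⟩
    · rw [← hπ, ← hπ, e.lt_iff_lt] at h2
      exact Or.inr ⟨h0, by rw [h1]; simpa using h2⟩
  · rw [← WordCopies.card_word_eq (κ := κ) x]
    exact Finset.card_bij (fun p _ => e p) (by simp [hit]) (fun _ _ _ _ h => e.injective h)
      fun y hy => ⟨e.symm y, by simpa [hit] using hy, by simp⟩

/-! ### Cycle counts -/

/-- Counting points instead of cycles allows the count to be split by itinerary. The case `i = 1` is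
separate since `cycleType` omits fixed points. -/
theorem mul_numCycles {n : ℕ} (π : Equiv.Perm (Fin n)) {i : ℕ} (hi : 0 < i) :
    i * numCycles i π = (Finset.univ.filter fun p => Function.minimalPeriod π p = i).card := by
  classical
  have hsupp : ∀ p, π p ≠ p →
      Function.minimalPeriod π p = (π.cycleOf p).support.card := by
    intro p hp
    rw [← card_permOrbitMk_eq]
    congr 1
    ext y
    rw [Equiv.Perm.mem_support_cycleOf_iff]
    simp only [Finset.mem_filter, Finset.mem_univ, true_and, Equiv.Perm.mem_support, hp, ne_eq,
      not_false_eq_true, and_true]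
    rw [permOrbitMk_eq_iff]
    constructor
    · rintro ⟨⟨_, ⟨k, rfl⟩⟩, rfl⟩; exact ⟨k, rfl⟩
    · rintro ⟨k, rfl⟩; exact ⟨⟨_, ⟨k, rfl⟩⟩, rfl⟩
  rw [numCycles, Equiv.Perm.parts_partition, Multiset.count_add, Multiset.count_replicate]
  rcases Nat.lt_or_ge 1 i with h1 | h1
  · rw [if_neg h1.ne, add_zero, Equiv.Perm.CycleType.count_def, Fintype.card_subtype]
    have hU : (Finset.univ.filter fun p => Function.minimalPeriod π p = i) =
        ((π.cycleFactorsFinset.filter fun c => c.support.card = i)).biUnion fun c => c.support := by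
      ext p
      simp only [Finset.mem_filter, Finset.mem_univ, true_and, Finset.mem_biUnion]
      constructor
      · intro h
        have hp : π p ≠ p := fun h' => by
          rw [Function.minimalPeriod_eq_one_iff_isFixedPt.2 h'] at h
          omega
        exact ⟨π.cycleOf p, ⟨Equiv.Perm.cycleOf_mem_cycleFactorsFinset_iff.2
          (Equiv.Perm.mem_support.2 hp), by rw [← hsupp p hp, h]⟩,
          Equiv.Perm.mem_support_cycleOf_iff.2 ⟨Equiv.Perm.SameCycle.refl _ _,
            Equiv.Perm.mem_support.2 hp⟩⟩
      · rintro ⟨c, ⟨hc, rfl⟩, hp⟩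
        have hc' := Equiv.Perm.cycle_is_cycleOf hp hc
        have hp' : π p ≠ p := Equiv.Perm.mem_support.1
          (Equiv.Perm.mem_cycleFactorsFinset_support_le hc hp)
        rw [hsupp p hp', ← hc']
    rw [hU, Finset.card_biUnion, Finset.sum_congr rfl
      (fun c hc => (Finset.mem_filter.1 hc).2), Finset.sum_const, smul_eq_mul, mul_comm]
    · congr 1
      rw [← Finset.card_map (Function.Embedding.subtype _)]
      congr 1
      ext c
      simp [and_comm]
    · intro c hc d hd hcd
      exact (π.cycleFactorsFinset_pairwise_disjoint (Finset.mem_filter.1 hc).1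
        (Finset.mem_filter.1 hd).1 hcd).disjoint_support
  · obtain rfl : i = 1 := by omega
    rw [if_pos rfl, one_mul, Multiset.count_eq_zero_of_notMem
      (fun h => absurd (Equiv.Perm.one_lt_of_mem_cycleType h) (lt_irrefl _)), zero_add,
      ← Finset.card_compl]
    congr 1
    ext p
    simp [Function.minimalPeriod_eq_one_iff_isFixedPt, Function.IsFixedPt]

/-- The square of `f` is strictly increasing on a finite chain, hence the identity. An involution
has as many fixed points as `F` has elements modulo 2, and an antitone map cannot fix two. -/
theorem card_fixedPoints_of_strictAnti {F : Type*} [Fintype F] [LinearOrder F] {f : F → F}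
    (hf : StrictAnti f) :
    (Finset.univ.filter fun a => f a = a).card = Fintype.card F % 2 := by
  have hinv : ∀ a, f (f a) = a := fun a =>
    le_antisymm (StrictMono.apply_le (hf.comp hf)) (StrictMono.le_apply (hf.comp hf))
  have hle : (Finset.univ.filter fun a => f a = a).card ≤ 1 := by
    refine Finset.card_le_one.2 fun a ha b hb => ?_
    simp only [Finset.mem_filter, Finset.mem_univ, true_and] at ha hb
    by_contra hab
    rcases lt_or_gt_of_ne hab with h | h
    · have := hf h; rw [ha, hb] at this; exact absurd h this.asymm
    · have := hf h; rw [ha, hb] at this; exact absurd h this.asymm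
  have hmod := Equiv.Perm.card_fixedPoints_modEq (f := (f : Function.End F)) (p := 2) (n := 1)
    (funext hinv)
  have hcard : Fintype.card (Function.fixedPoints f) =
      (Finset.univ.filter fun a => f a = a).card := by
    rw [Fintype.card_subtype]; rfl
  have hmod' : Fintype.card F % 2 = (Finset.univ.filter fun a => f a = a).card % 2 := by
    rw [← hcard]; exact hmod
  omega

section FiberPeriods

variable {m n L : ℕ} [NeZero L] {w : Fin n → ShelfPlacement m} {π : Equiv.Perm (Fin n)}

/-- The points with itinerary `x`. -/
abbrev ItineraryFiber (L : ℕ) (w : Fin n → ShelfPlacement m) (π : Equiv.Perm (Fin n))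
    (x : CircWord L m) : Type :=
  {p : Fin n // itinerary L w π p = x}

/-- A power of `π` acting on the points with itinerary `x`. -/
def fiberMap (hL : π ^ L = 1) {x : CircWord L m} {k : ℕ}
    (hk : Function.IsPeriodicPt (rotateWord L m) k x) (p : ItineraryFiber L w π x) :
    ItineraryFiber L w π x :=
  ⟨(π ^ k) p, by rw [itinerary_pow_apply hL, p.2]; exact hk⟩

theorem fiberMap_strictMono (hL : π ^ L = 1) (hG : ∀ i j, i < j → EndsAbove w (π i) (π j))
    {x : CircWord L m} {k : ℕ} (hk : Function.IsPeriodicPt (rotateWord L m) k x)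
    (hs : prefixSign x k = 1) : StrictMono (fiberMap (w := w) hL hk) := by
  intro p q hpq
  have := sign_mul_pow_lt hL hG k (p := p.1) (q := q.1) hpq (p.2.trans q.2.symm)
  rw [p.2, hs] at this
  have h2 : (π ^ k) p.1 < (π ^ k) q.1 := by simpa using this
  exact h2

theorem fiberMap_strictAnti (hL : π ^ L = 1) (hG : ∀ i j, i < j → EndsAbove w (π i) (π j))
    {x : CircWord L m} {k : ℕ} (hk : Function.IsPeriodicPt (rotateWord L m) k x)
    (hs : prefixSign x k = -1) : StrictAnti (fiberMap (w := w) hL hk) := by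
  intro p q hpq
  have := sign_mul_pow_lt hL hG k (p := p.1) (q := q.1) hpq (p.2.trans q.2.symm)
  rw [p.2, hs] at this
  have h2 : (π ^ k) q.1 < (π ^ k) p.1 := by simpa using this
  exact h2

/-- The number of `i`-cycles contributed by an orbit of words of length `d` with sign `s` and
multiplicity `k`. -/
def orbitCycles (s : ℤ) (d k i : ℕ) : ℕ :=
  if s = 1 then (if i = d then k else 0)
  else (if i = d then k % 2 else 0) + (if i = 2 * d then k / 2 else 0)

theorem minimalPeriod_word_dvd (hL : π ^ L = 1) {x : CircWord L m}
    (p : ItineraryFiber L w π x) :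
    Function.minimalPeriod (rotateWord L m) x ∣ Function.minimalPeriod π p.1 := by
  apply Function.IsPeriodicPt.minimalPeriod_dvd
  have h := itinerary_pow_apply (w := w) hL p.1 (Function.minimalPeriod π p.1)
  rw [← Equiv.Perm.iterate_eq_pow, (Function.isPeriodicPt_minimalPeriod π p.1).eq, p.2] at h
  exact h.symm

theorem minimalPeriod_word_pos (x : CircWord L m) :
    0 < Function.minimalPeriod (rotateWord L m) x :=
  Function.minimalPeriod_pos_of_mem_periodicPts
    ((rotateWord L m).injective.mem_periodicPts x)

/-- With `d` the period of `x`, the map `π ^ d` on the fiber is the identity or an order-reversing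
involution, so the points have period `d`, or `d` and `2 * d`. The factor `d` accounts for the `d`
rotations of `x`, the factor `i` for the points of an `i`-cycle. -/
theorem card_minimalPeriod_fiber (hL : π ^ L = 1)
    (hG : ∀ i j, i < j → EndsAbove w (π i) (π j)) (x : CircWord L m) (i : ℕ) :
    Function.minimalPeriod (rotateWord L m) x *
      (Finset.univ.filter fun p : ItineraryFiber L w π x =>
        Function.minimalPeriod π p.1 = i).card =
    i * orbitCycles (prefixSign x (Function.minimalPeriod (rotateWord L m) x))
      (Function.minimalPeriod (rotateWord L m) x) (Fintype.card (ItineraryFiber L w π x)) i := by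
  have hk := Function.isPeriodicPt_minimalPeriod (rotateWord L m) x
  have hpos := minimalPeriod_word_pos x
  have hdvd := fun p => minimalPeriod_word_dvd (w := w) hL (x := x) p
  set d := Function.minimalPeriod (rotateWord L m) x with hd
  have hfix : ∀ p : ItineraryFiber L w π x,
      fiberMap hL hk p = p ↔ Function.minimalPeriod π p.1 = d := by
    intro p
    rw [Subtype.ext_iff]
    constructor
    · intro h
      refine Nat.dvd_antisymm (Function.IsPeriodicPt.minimalPeriod_dvd ?_) (hdvd p)
      rw [Function.IsPeriodicPt, Function.IsFixedPt, Equiv.Perm.iterate_eq_pow]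
      exact h
    · intro h
      have := Function.isPeriodicPt_minimalPeriod π p.1
      rw [h, Function.IsPeriodicPt, Function.IsFixedPt, Equiv.Perm.iterate_eq_pow] at this
      exact this
  rcases prefixSign_eq x d with hs | hs
  · have hall : ∀ p : ItineraryFiber L w π x, Function.minimalPeriod π p.1 = d := fun p =>
      (hfix p).1 (le_antisymm (StrictMono.apply_le (fiberMap_strictMono hL hG hk hs))
        (StrictMono.le_apply (fiberMap_strictMono hL hG hk hs)))
    rw [orbitCycles, if_pos hs]
    simp only [hall]
    by_cases hi : i = d
    · simp [hi]
    · simp [hi, Ne.symm hi]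
  · have hanti := fiberMap_strictAnti (w := w) hL hG hk hs
    have hall : ∀ p : ItineraryFiber L w π x, Function.minimalPeriod π p.1 = d ∨
        Function.minimalPeriod π p.1 = 2 * d := by
      intro p
      have h2 : fiberMap hL hk (fiberMap hL hk p) = p :=
        le_antisymm (StrictMono.apply_le (hanti.comp hanti)) (StrictMono.le_apply (hanti.comp hanti))
      have h3 : Function.minimalPeriod π p.1 ∣ 2 * d := by
        apply Function.IsPeriodicPt.minimalPeriod_dvd
        rw [Function.IsPeriodicPt, Function.IsFixedPt, Equiv.Perm.iterate_eq_pow, two_mul, pow_add]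
        exact congrArg Subtype.val h2
      obtain ⟨c, hc⟩ := hdvd p
      rw [hc, mul_comm 2 d] at h3
      have h4 := (Nat.dvd_prime Nat.prime_two).1 (Nat.dvd_of_mul_dvd_mul_left hpos h3)
      rcases h4 with rfl | rfl
      · left; omega
      · right; omega
    have hcardfix := card_fixedPoints_of_strictAnti hanti
    simp only [hfix] at hcardfix
    have hsplit := Finset.card_filter_add_card_filter_not (s := Finset.univ)
      (fun p : ItineraryFiber L w π x => Function.minimalPeriod π p.1 = d)
    have hneg : (Finset.univ.filter fun p : ItineraryFiber L w π x =>
        ¬ Function.minimalPeriod π p.1 = d) =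
        Finset.univ.filter fun p : ItineraryFiber L w π x =>
          Function.minimalPeriod π p.1 = 2 * d := by
      ext p
      have := hall p
      simp only [Finset.mem_filter, Finset.mem_univ, true_and]
      omega
    rw [hneg, hcardfix, Finset.card_univ] at hsplit
    rw [orbitCycles, if_neg (by rw [hs]; norm_num)]
    by_cases hi : i = d
    · rw [if_pos hi, if_neg (by omega), hi, hcardfix, add_zero]
    · by_cases hi2 : i = 2 * d
      · rw [if_neg hi, if_pos hi2, hi2, zero_add, mul_comm 2 d, mul_assoc, mul_comm d 2]
        congr 1
        omega
      · rw [if_neg hi, if_neg hi2, add_zero, mul_zero, Finset.filter_false_of_mem,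
          Finset.card_empty, mul_zero]
        intro p _ h
        have := hall p
        omega

end FiberPeriods

/-! ### Orbits of circular words and the shuffle sum -/

/-- The hypothesis forces `c` to be constant on each orbit, whose size is the minimal period. -/
theorem sum_eq_sum_permOrbit {X : Type*} [Fintype X] [DecidableEq X] (T : Equiv.Perm X)
    [Fintype (PermOrbit T)] [DecidableEq (PermOrbit T)] (c : X → ℕ) (G : PermOrbit T → ℕ)
    (h : ∀ x, Function.minimalPeriod T x * c x = G (permOrbitMk T x)) :
    ∑ x, c x = ∑ ν, G ν := by
  rw [← Finset.sum_fiberwise_of_maps_to (g := permOrbitMk T) (fun _ _ => Finset.mem_univ _)]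
  refine Finset.sum_congr rfl fun ν _ => ?_
  obtain ⟨x, rfl⟩ := Quotient.exists_rep ν
  change ∑ y ∈ Finset.univ.filter (fun y => permOrbitMk T y = permOrbitMk T x), c y =
    G (permOrbitMk T x)
  have hpos : 0 < Function.minimalPeriod T x :=
    Function.minimalPeriod_pos_of_mem_periodicPts (T.injective.mem_periodicPts x)
  rw [Finset.sum_congr rfl (g := fun _ => c x), Finset.sum_const, smul_eq_mul,
    card_permOrbitMk_eq, h]
  intro y hy
  have hy' : permOrbitMk T y = permOrbitMk T x := (Finset.mem_filter.1 hy).2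
  have hm : Function.minimalPeriod T y = Function.minimalPeriod T x := by
    rw [← card_permOrbitMk_eq, ← card_permOrbitMk_eq, hy']
  have h2 := h y
  rw [hm, hy', ← h x] at h2
  exact Nat.eq_of_mul_eq_mul_left hpos h2

section Orbits

variable {m L : ℕ}

/-- The orbits of circular words under rotation. -/
abbrev WordOrbit (L m : ℕ) : Type := PermOrbit (rotateWord L m)

/-- The size of an orbit of circular words. -/
noncomputable def orbitLen (ν : WordOrbit L m) : ℕ :=
  Function.minimalPeriod (rotateWord L m) ν.out

/-- The sign of an orbit of circular words: the product of the signs over a period. -/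
noncomputable def orbitSign (ν : WordOrbit L m) : ℤ :=
  prefixSign ν.out (orbitLen ν)

theorem permOrbitMk_out (ν : WordOrbit L m) : permOrbitMk (rotateWord L m) ν.out = ν :=
  Quotient.out_eq' ν

theorem orbitSign_eq (ν : WordOrbit L m) : orbitSign ν = 1 ∨ orbitSign ν = -1 :=
  prefixSign_eq _ _

variable [NeZero L]

noncomputable instance : Fintype (WordOrbit L m) := Fintype.ofFinite _

noncomputable instance : DecidableEq (WordOrbit L m) := Classical.decEq _

theorem orbitLen_mk (x : CircWord L m) :
    orbitLen (permOrbitMk (rotateWord L m) x) = Function.minimalPeriod (rotateWord L m) x := by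
  rw [orbitLen, ← card_permOrbitMk_eq, ← card_permOrbitMk_eq, permOrbitMk_out]

theorem orbitLen_pos (ν : WordOrbit L m) : 0 < orbitLen ν := minimalPeriod_word_pos _

theorem orbitSign_mk (x : CircWord L m) :
    orbitSign (permOrbitMk (rotateWord L m) x) =
      prefixSign x (Function.minimalPeriod (rotateWord L m) x) := by
  have hinv : ∀ y : CircWord L m,
      prefixSign (rotateWord L m y) (orbitLen (permOrbitMk _ (rotateWord L m y))) =
      prefixSign y (orbitLen (permOrbitMk _ y)) := fun y => by
    rw [permOrbitMk_apply, orbitLen_mk,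
      prefixSign_rotate _ (Function.isPeriodicPt_minimalPeriod _ y)]
  have := eq_of_permOrbitMk_eq
    (g := fun y => prefixSign y (orbitLen (permOrbitMk (rotateWord L m) y))) hinv
    (permOrbitMk_out (permOrbitMk (rotateWord L m) x))
  rw [orbitLen_mk x, permOrbitMk_out] at this
  exact this

variable {n : ℕ} {w : Fin n → ShelfPlacement m} {π : Equiv.Perm (Fin n)}

/-- The number of points whose itinerary lies in a given orbit. -/
noncomputable def orbitMult (L : ℕ) [NeZero L] (w : Fin n → ShelfPlacement m)
    (π : Equiv.Perm (Fin n)) : WordOrbit L m →₀ ℕ :=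
  Finsupp.equivFunOnFinite.symm fun ν =>
    (Finset.univ.filter fun p => permOrbitMk (rotateWord L m) (itinerary L w π p) = ν).card

theorem orbitMult_apply (ν : WordOrbit L m) : orbitMult L w π ν =
    (Finset.univ.filter fun p => permOrbitMk (rotateWord L m) (itinerary L w π p) = ν).card := rfl

theorem card_itinerary_rotate (hL : π ^ L = 1) (x : CircWord L m) :
    (Finset.univ.filter fun p => itinerary L w π p = rotateWord L m x).card =
      (Finset.univ.filter fun p => itinerary L w π p = x).card := by
  symm
  refine Finset.card_bij (fun p _ => π p) ?_ (fun _ _ _ _ h => π.injective h) ?_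
  · intro p hp
    simp only [Finset.mem_filter, Finset.mem_univ, true_and] at hp ⊢
    rw [itinerary_apply hL, hp]
  · intro q hq
    simp only [Finset.mem_filter, Finset.mem_univ, true_and] at hq
    refine ⟨π.symm q, ?_, by simp⟩
    simp only [Finset.mem_filter, Finset.mem_univ, true_and]
    apply (rotateWord L m).injective
    rw [← itinerary_apply hL]
    simpa using hq

/-- `π` maps the points with itinerary `x` onto those with the rotated itinerary, so all words of an
orbit have equal multiplicity. -/
theorem orbitMult_mk (hL : π ^ L = 1) (x : CircWord L m) :
    orbitMult L w π (permOrbitMk (rotateWord L m) x) =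
      Function.minimalPeriod (rotateWord L m) x *
        (Finset.univ.filter fun p => itinerary L w π p = x).card := by
  rw [orbitMult_apply, Finset.card_eq_sum_card_fiberwise (f := itinerary L w π)
    (t := Finset.univ.filter fun y =>
      permOrbitMk (rotateWord L m) y = permOrbitMk (rotateWord L m) x)
    (fun p hp => by simpa using hp), ← card_permOrbitMk_eq, ← smul_eq_mul, ← Finset.sum_const]
  refine Finset.sum_congr rfl fun y hy => ?_
  have hy' := (Finset.mem_filter.1 hy).2
  rw [← eq_of_permOrbitMk_eq (g := fun x =>
    (Finset.univ.filter fun p => itinerary L w π p = x).card) (card_itinerary_rotate hL) hy',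
    Finset.filter_filter]
  congr 1
  ext p
  simp only [Finset.mem_filter, Finset.mem_univ, true_and, and_iff_right_iff_imp]
  rintro rfl
  exact hy'

theorem sum_orbitMult : ∑ ν, orbitMult L w π ν = n := by
  have := Finset.card_eq_sum_card_fiberwise (s := (Finset.univ : Finset (Fin n)))
    (f := fun p => permOrbitMk (rotateWord L m) (itinerary L w π p)) (t := Finset.univ)
    (fun _ _ => Finset.mem_univ _)
  rw [Finset.card_univ, Fintype.card_fin] at this
  exact this.symm

theorem orbitLen_dvd_orbitMult (hL : π ^ L = 1) (ν : WordOrbit L m) :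
    orbitLen ν ∣ orbitMult L w π ν := by
  rw [← permOrbitMk_out ν, orbitMult_mk hL, orbitLen_mk]
  exact dvd_mul_right _ _

theorem numCycles_eq_sum_orbitCycles (hL : π ^ L = 1)
    (hG : ∀ i j, i < j → EndsAbove w (π i) (π j)) {i : ℕ} (hi : 0 < i) :
    numCycles i π =
      ∑ ν : WordOrbit L m, orbitCycles (orbitSign ν) (orbitLen ν)
        (orbitMult L w π ν / orbitLen ν) i := by
  apply Nat.eq_of_mul_eq_mul_left hi
  rw [mul_numCycles π hi, Finset.mul_sum,
    Finset.card_eq_sum_card_fiberwise (f := itinerary L w π) (t := Finset.univ)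
      (fun _ _ => Finset.mem_univ _)]
  refine sum_eq_sum_permOrbit (rotateWord L m) _ _ fun x => ?_
  rw [orbitSign_mk, orbitLen_mk, orbitMult_mk hL,
    Nat.mul_div_cancel_left _ (minimalPeriod_word_pos x)]
  have := card_minimalPeriod_fiber hL hG x i
  rw [Fintype.card_subtype] at this
  rw [← this, Finset.filter_filter]
  congr 1
  rw [← Finset.card_map (Function.Embedding.subtype _)]
  congr 1
  ext p
  simp [and_comm]

theorem orbitMult_injective {w' : Fin n → ShelfPlacement m} {π' : Equiv.Perm (Fin n)}
    (hL : π ^ L = 1) (hL' : π' ^ L = 1) (hG : ∀ i j, i < j → EndsAbove w (π i) (π j))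
    (hG' : ∀ i j, i < j → EndsAbove w' (π' i) (π' j))
    (h : orbitMult L w π = orbitMult L w' π') : π = π' ∧ w = w' := by
  refine eq_of_card_itinerary_eq hL hL' hG hG' fun x => ?_
  have := DFunLike.congr_fun h (permOrbitMk (rotateWord L m) x)
  rw [orbitMult_mk hL, orbitMult_mk hL'] at this
  exact Nat.eq_of_mul_eq_mul_left (minimalPeriod_word_pos x) this

theorem exists_orbitMult_eq (hL : ∀ π : Equiv.Perm (Fin n), π ^ L = 1) (l : WordOrbit L m →₀ ℕ)
    (hl : ∀ ν, orbitLen ν ∣ l ν) (hn : ∑ ν, l ν = n) :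
    ∃ (π : Equiv.Perm (Fin n)) (w : Fin n → ShelfPlacement m),
      (∀ i j, i < j → EndsAbove w (π i) (π j)) ∧ orbitMult L w π = l := by
  obtain ⟨π, w, hG, h⟩ := exists_card_itinerary_eq (L := L) (m := m) (n := n)
    (κ := fun x => l (permOrbitMk _ x) / orbitLen (permOrbitMk _ x))
    (fun x => by rw [permOrbitMk_apply]) (by
      rw [sum_eq_sum_permOrbit (rotateWord L m) _ l, hn]
      intro x
      rw [← orbitLen_mk, Nat.mul_div_cancel' (hl _)])
  refine ⟨π, w, hG, Finsupp.ext fun ν => ?_⟩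
  rw [← permOrbitMk_out ν, orbitMult_mk (hL π), h, ← orbitLen_mk, Nat.mul_div_cancel' (hl _)]

end Orbits

/-- The monomial contributed by an orbit of length `d` with sign `s` and multiplicity `k`. -/
def orbitWeight {R : Type*} [CommSemiring R] (z : ℕ → R) (s : ℤ) (d k : ℕ) : R :=
  if s = 1 then z d ^ k else z d ^ (k % 2) * z (2 * d) ^ (k / 2)

theorem prod_pow_ite_eq {R : Type*} [CommSemiring R] (z : ℕ → R) {n d k : ℕ} (hd : 0 < d)
    (h : d * k ≤ n) : ∏ i ∈ Finset.Icc 1 n, z i ^ (if i = d then k else 0) = z d ^ k := by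
  -- For `k = 0` nothing bounds `d` by `n`, but both sides are `1`.
  rcases Nat.eq_zero_or_pos k with rfl | hk
  · simp
  · rw [Finset.prod_eq_single d (fun i _ hi => by rw [if_neg hi, pow_zero]), if_pos rfl]
    intro hmem
    exact absurd (Finset.mem_Icc.2 ⟨hd, (Nat.le_mul_of_pos_right d hk).trans h⟩) hmem

theorem prod_pow_orbitCycles {R : Type*} [CommSemiring R] (z : ℕ → R) (s : ℤ) {n d k : ℕ}
    (hd : 0 < d) (h : d * k ≤ n) :
    ∏ i ∈ Finset.Icc 1 n, z i ^ orbitCycles s d k i = orbitWeight z s d k := by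
  by_cases hs : s = 1
  · simp only [orbitCycles, orbitWeight, if_pos hs]
    exact prod_pow_ite_eq z hd h
  · simp only [orbitCycles, orbitWeight, if_neg hs, pow_add, Finset.prod_mul_distrib]
    rw [prod_pow_ite_eq z hd ((Nat.mul_le_mul_left d (Nat.mod_le k 2)).trans h),
      prod_pow_ite_eq z (by omega : 0 < 2 * d)]
    refine le_trans ?_ h
    rw [mul_comm 2 d, mul_assoc]
    exact Nat.mul_le_mul_left d (Nat.mul_div_le k 2)

/-- The bijection with multiplicity vectors turns the cycle monomial into a product over orbits. The
right side is the `n`-th coefficient of the product of the `orbitSeries`. -/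
theorem sum_shuffles_eq {R : Type*} [CommSemiring R] (z : ℕ → R) {m n L : ℕ} [NeZero L]
    (hL : ∀ π : Equiv.Perm (Fin n), π ^ L = 1) :
    ∑ π : Equiv.Perm (Fin n), ∑ w : Fin n → ShelfPlacement m,
      (if lazyDeck w = List.ofFn π then ∏ i ∈ Finset.Icc 1 n, z i ^ numCycles i π else 0) =
    ∑ l ∈ Finset.finsuppAntidiag (Finset.univ : Finset (WordOrbit L m)) n,
      ∏ ν, (if orbitLen ν ∣ l ν then
        orbitWeight z (orbitSign ν) (orbitLen ν) (l ν / orbitLen ν) else 0) := by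
  classical
  rw [← Fintype.sum_prod_type' (f := fun (π : Equiv.Perm (Fin n)) (w : Fin n → ShelfPlacement m) =>
    (if lazyDeck w = List.ofFn π then ∏ i ∈ Finset.Icc 1 n, z i ^ numCycles i π else 0)),
    ← Finset.sum_filter]
  have hmem : ∀ l : WordOrbit L m →₀ ℕ,
      l ∈ Finset.finsuppAntidiag (Finset.univ : Finset (WordOrbit L m)) n ↔ ∑ ν, l ν = n :=
    fun l => by simp [Finset.mem_finsuppAntidiag]
  have hR : ∑ l ∈ Finset.finsuppAntidiag (Finset.univ : Finset (WordOrbit L m)) n,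
      ∏ ν, (if orbitLen ν ∣ l ν then
        orbitWeight z (orbitSign ν) (orbitLen ν) (l ν / orbitLen ν) else 0) =
      ∑ l ∈ (Finset.finsuppAntidiag (Finset.univ : Finset (WordOrbit L m)) n).filter
        (fun l => ∀ ν, orbitLen ν ∣ l ν),
        ∏ ν, orbitWeight z (orbitSign ν) (orbitLen ν) (l ν / orbitLen ν) := by
    rw [Finset.sum_filter]
    refine Finset.sum_congr rfl fun l _ => ?_
    split_ifs with h
    · exact Finset.prod_congr rfl fun ν _ => if_pos (h ν)
    · obtain ⟨ν, hν⟩ := not_forall.1 h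
      exact Finset.prod_eq_zero (Finset.mem_univ ν) (if_neg hν)
  rw [hR]
  refine Finset.sum_bij (fun a _ => orbitMult L a.2 a.1) ?_ ?_ ?_ ?_
  · exact fun a _ => Finset.mem_filter.2
      ⟨(hmem _).2 sum_orbitMult, fun ν => orbitLen_dvd_orbitMult (hL _) ν⟩
  · intro a ha b hb hab
    have ha' := (lazyDeck_eq_ofFn_iff _ _).1 (Finset.mem_filter.1 ha).2
    have hb' := (lazyDeck_eq_ofFn_iff _ _).1 (Finset.mem_filter.1 hb).2
    obtain ⟨h1, h2⟩ := orbitMult_injective (hL _) (hL _) ha' hb' hab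
    exact Prod.ext h1 h2
  · intro l hl
    obtain ⟨hl, hdvd⟩ := Finset.mem_filter.1 hl
    obtain ⟨π, w, hG, h⟩ := exists_orbitMult_eq hL l hdvd
      ((hmem l).1 hl)
    exact ⟨(π, w), Finset.mem_filter.2 ⟨Finset.mem_univ _, (lazyDeck_eq_ofFn_iff _ _).2 hG⟩, h⟩
  · intro a ha
    have ha' := (lazyDeck_eq_ofFn_iff _ _).1 (Finset.mem_filter.1 ha).2
    rw [Finset.prod_congr rfl fun i hi => by
      rw [numCycles_eq_sum_orbitCycles (hL a.1) ha' (Finset.mem_Icc.1 hi).1,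
        ← Finset.prod_pow_eq_pow_sum], Finset.prod_comm]
    refine Finset.prod_congr rfl fun ν _ => prod_pow_orbitCycles z _ (orbitLen_pos ν) ?_
    rw [Nat.mul_div_cancel' (orbitLen_dvd_orbitMult (hL _) ν)]
    calc orbitMult L a.2 a.1 ν ≤ ∑ ν, orbitMult L a.2 a.1 ν :=
          Finset.single_le_sum (fun _ _ => Nat.zero_le _) (Finset.mem_univ ν)
      _ = n := sum_orbitMult

/-! ### Counting orbits of circular words -/

section Counting

variable {m : ℕ}

/-- Tops and bottoms of ordinary shelves cancel; the lazy shelf is left over. -/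
theorem sum_placementSign : ∑ a : ShelfPlacement m, placementSign a = 1 := by
  rw [Fintype.sum_option, Fintype.sum_prod_type]
  simp [placementSign]

theorem card_shelfPlacement : Fintype.card (ShelfPlacement m) = 2 * m + 1 := by
  simp [mul_comm]

variable {L : ℕ}

theorem isPeriodicPt_rotateWord_iff {x : CircWord L m} {i : ℕ} :
    Function.IsPeriodicPt (rotateWord L m) i x ↔ ∀ j, x (j + i) = x j := by
  constructor
  · exact fun h j => (rotateWord_iterate x i j).symm.trans (congrFun h.eq j)
  · exact fun h => funext fun j => (rotateWord_iterate x i j).trans (h j)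

theorem prefixSign_mul {x : CircWord L m} {d : ℕ}
    (h : Function.IsPeriodicPt (rotateWord L m) d x) (k : ℕ) :
    prefixSign x (d * k) = prefixSign x d ^ k := by
  induction k with
  | zero => simp [prefixSign]
  | succ k ih =>
    rw [pow_succ, ← ih, mul_add_one, prefixSign, Finset.prod_range_add]
    congr 1
    refine Finset.prod_congr rfl fun j _ => ?_
    have := isPeriodicPt_rotateWord_iff.1 (h.mul_const k) (j : ZMod L)
    rw [← this]
    push_cast
    rw [add_comm]

/-- The circular word of length `L` repeating `y`. -/
def repeatWord (L : ℕ) {i : ℕ} [NeZero i] (y : Fin i → ShelfPlacement m) : CircWord L m :=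
  fun j => y ⟨j.val % i, Nat.mod_lt _ (NeZero.pos i)⟩

theorem repeatWord_natCast {i : ℕ} [NeZero i] (hi : i ∣ L) (y : Fin i → ShelfPlacement m)
    (k : ℕ) : repeatWord L y (k : ZMod L) = y ⟨k % i, Nat.mod_lt _ (NeZero.pos i)⟩ := by
  simp only [repeatWord, ZMod.val_natCast, Nat.mod_mod_of_dvd _ hi]

variable [NeZero L]

/-- A word fixed by the `i`-th rotation is given by its first `i` letters, which are arbitrary since
`i ∣ L`. -/
theorem sum_periodic_eq {i : ℕ} [NeZero i] (hi : i ∣ L) (F : CircWord L m → ℤ) :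
    ∑ x ∈ Finset.univ.filter (fun x => (rotateWord L m)^[i] x = x), F x =
      ∑ y : Fin i → ShelfPlacement m, F (repeatWord L y) := by
  symm
  refine Finset.sum_bij (fun y _ => repeatWord L y) ?_ ?_ ?_ fun _ _ => rfl
  · intro y _
    refine Finset.mem_filter.2 ⟨Finset.mem_univ _, isPeriodicPt_rotateWord_iff.2 fun j => ?_⟩
    have h1 := repeatWord_natCast hi y (j.val + i)
    have h2 := repeatWord_natCast hi y j.val
    rw [Nat.cast_add, ZMod.natCast_zmod_val] at h1
    rw [ZMod.natCast_zmod_val] at h2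
    rw [h1, h2]
    simp
  · intro y _ y' _ h
    funext k
    have h1 := repeatWord_natCast hi y k
    have h2 := repeatWord_natCast hi y' k
    change repeatWord L y = repeatWord L y' at h
    rw [h, h2] at h1
    simpa [Nat.mod_eq_of_lt k.2] using h1.symm
  · intro x hx
    have hx' := isPeriodicPt_rotateWord_iff.1 (Finset.mem_filter.1 hx).2
    have hmod : ∀ q k : ℕ, x ((k + q * i : ℕ) : ZMod L) = x (k : ZMod L) := by
      intro q
      induction q with
      | zero => simp
      | succ q ih =>
        intro k
        rw [← ih k, ← hx' ((k + q * i : ℕ) : ZMod L)]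
        push_cast
        congr 1
        ring
    refine ⟨fun k => x ((k : ℕ) : ZMod L), Finset.mem_univ _, funext fun j => ?_⟩
    change x ((j.val % i : ℕ) : ZMod L) = x j
    rw [← hmod (j.val / i), Nat.mod_add_div', ZMod.natCast_zmod_val]

theorem card_periodic {i : ℕ} [NeZero i] (hi : i ∣ L) :
    (Finset.univ.filter fun x : CircWord L m => (rotateWord L m)^[i] x = x).card =
      (2 * m + 1) ^ i := by
  have := sum_periodic_eq (m := m) hi (fun _ => 1)
  simp only [Finset.sum_const, Finset.card_univ, Fintype.card_fun, card_shelfPlacement,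
    Fintype.card_fin, nsmul_eq_mul, mul_one] at this
  exact_mod_cast this

theorem sum_prefixSign_periodic {i : ℕ} [NeZero i] (hi : i ∣ L) :
    ∑ x ∈ Finset.univ.filter (fun x : CircWord L m => (rotateWord L m)^[i] x = x),
      prefixSign x i = 1 := by
  rw [sum_periodic_eq hi, ← one_pow i, ← sum_placementSign (m := m), Fintype.sum_pow]
  refine Finset.sum_congr rfl fun y _ => ?_
  rw [prefixSign, Finset.prod_range]
  refine Finset.prod_congr rfl fun k _ => ?_
  rw [repeatWord_natCast hi]
  simp [Nat.mod_eq_of_lt k.2]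

theorem two_mul_card_odd_add_one {i : ℕ} [NeZero i] (hi : i ∣ L) :
    2 * (Finset.univ.filter fun x : CircWord L m =>
      (rotateWord L m)^[i] x = x ∧ prefixSign x i = -1).card + 1 = (2 * m + 1) ^ i := by
  have h1 := card_periodic (m := m) hi
  have h2 := sum_prefixSign_periodic (m := m) hi
  have h3 : ∀ x : CircWord L m, prefixSign x i = 1 - 2 * (if prefixSign x i = -1 then 1 else 0) := by
    intro x
    rcases prefixSign_eq x i with h | h <;> simp [h]
  rw [Finset.sum_congr rfl fun x _ => h3 x, Finset.sum_sub_distrib, Finset.sum_const, h1,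
    ← Finset.mul_sum, Finset.sum_boole, Finset.filter_filter] at h2
  zify
  simp only [nsmul_eq_mul, mul_one] at h2
  push_cast at h2
  linarith

theorem isPeriodicPt_iff_orbitLen_dvd (x : CircWord L m) (i : ℕ) :
    (rotateWord L m)^[i] x = x ↔ orbitLen (permOrbitMk (rotateWord L m) x) ∣ i := by
  rw [orbitLen_mk]
  exact Function.isPeriodicPt_iff_minimalPeriod_dvd

theorem prefixSign_eq_orbitSign_pow (x : CircWord L m) {i : ℕ}
    (h : orbitLen (permOrbitMk (rotateWord L m) x) ∣ i) :
    prefixSign x i = orbitSign (permOrbitMk (rotateWord L m) x) ^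
      (i / orbitLen (permOrbitMk (rotateWord L m) x)) := by
  conv_lhs => rw [← Nat.mul_div_cancel' h]
  rw [orbitSign_mk, orbitLen_mk, prefixSign_mul (Function.isPeriodicPt_minimalPeriod _ _)]

/-- The number of orbits of circular words with given length and sign. -/
noncomputable def orbitCount (L m : ℕ) [NeZero L] (s : ℤ) (d : ℕ) : ℕ :=
  (Finset.univ.filter fun ν : WordOrbit L m => orbitLen ν = d ∧ orbitSign ν = s).card

theorem sum_orbit_eq_sum_divisors {i : ℕ} (hi : i ≠ 0) (s : ℤ) (P : ℕ → Prop)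
    [DecidablePred P] :
    ∑ ν : WordOrbit L m, (if orbitLen ν ∣ i ∧ P (orbitLen ν) ∧ orbitSign ν = s
      then orbitLen ν else 0) =
    ∑ d ∈ i.divisors, if P d then d * orbitCount L m s d else 0 := by
  classical
  rw [← Finset.sum_filter,
    ← Finset.sum_fiberwise_of_maps_to (g := orbitLen) (t := i.divisors)
      (fun ν hν => Nat.mem_divisors.2 ⟨(Finset.mem_filter.1 hν).2.1, hi⟩)]
  refine Finset.sum_congr rfl fun d hd => ?_
  have hd' := Nat.dvd_of_mem_divisors hd
  rw [Finset.sum_congr rfl (g := fun _ => d) (fun ν hν => (Finset.mem_filter.1 hν).2),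
    Finset.sum_const, smul_eq_mul, mul_comm, Finset.filter_filter]
  split_ifs with hP
  · congr 2
    ext ν
    simp only [Finset.mem_filter, Finset.mem_univ, true_and]
    constructor
    · rintro ⟨⟨-, -, h⟩, h'⟩; exact ⟨h', h⟩
    · rintro ⟨rfl, h⟩; exact ⟨⟨hd', hP, h⟩, rfl⟩
  · rw [Finset.filter_false_of_mem, Finset.card_empty, mul_zero]
    rintro ν - ⟨⟨-, h, -⟩, rfl⟩
    exact hP h

/-- A word in an orbit of length `d ∣ i` has sign `orbitSign ^ (i / d)` over `i` letters; this is
`-1` only for a negative orbit with `i / d` odd. -/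
theorem two_mul_sum_orbitCount_odd {i : ℕ} [NeZero i] (hi : i ∣ L) :
    2 * (∑ d ∈ i.divisors, if Odd (i / d) then d * orbitCount L m (-1) d else 0) + 1 =
      (2 * m + 1) ^ i := by
  rw [← two_mul_card_odd_add_one (m := m) hi, Finset.card_filter,
    ← sum_orbit_eq_sum_divisors (NeZero.ne i) (-1) (fun d => Odd (i / d)),
    sum_eq_sum_permOrbit (rotateWord L m)]
  intro x
  simp only [← orbitLen_mk, isPeriodicPt_iff_orbitLen_dvd]
  by_cases h : orbitLen (permOrbitMk (rotateWord L m) x) ∣ i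
  · rw [prefixSign_eq_orbitSign_pow x h]
    rcases orbitSign_eq (permOrbitMk (rotateWord L m) x) with h' | h'
    · rw [h']; simp
    · rw [h']
      rcases Nat.even_or_odd (i / orbitLen (permOrbitMk (rotateWord L m) x)) with h2 | h2
      · simp [h, h2.neg_one_pow, Nat.not_odd_iff_even.2 h2]
      · simp [h, h2.neg_one_pow, h2]
  · simp [h]

theorem sum_orbitCount {i : ℕ} [NeZero i] (hi : i ∣ L) :
    ∑ d ∈ i.divisors, d * orbitCount L m 1 d + ∑ d ∈ i.divisors, d * orbitCount L m (-1) d =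
      (2 * m + 1) ^ i := by
  have h := fun s => sum_orbit_eq_sum_divisors (L := L) (m := m) (NeZero.ne i) s (fun _ => True)
  simp only [if_true, true_and] at h
  rw [← card_periodic (m := m) hi, ← h, ← h, ← Finset.sum_add_distrib, Finset.card_filter,
    sum_eq_sum_permOrbit (rotateWord L m)]
  intro x
  simp only [← orbitLen_mk, isPeriodicPt_iff_orbitLen_dvd]
  by_cases h : orbitLen (permOrbitMk (rotateWord L m) x) ∣ i
  · rcases orbitSign_eq (permOrbitMk (rotateWord L m) x) with h' | h' <;> simp [h, h']
  · simp [h]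

/-- The positive orbits of length `i` together with the negative orbits of length `i / 2` are as many
as the negative orbits of length `i`, except for one more if `i = 1`. -/
theorem orbitCount_one_add {i : ℕ} [NeZero i] (hi : i ∣ L) :
    orbitCount L m 1 i + (if 2 ∣ i then orbitCount L m (-1) (i / 2) else 0) =
      orbitCount L m (-1) i + (if i = 1 then 1 else 0) := by
  -- The identity is proved first as a divisor sum; strong induction then cancels the proper
  -- divisors.
  have key : ∀ i : ℕ, i ≠ 0 → i ∣ L → ∑ d ∈ i.divisors,
      d * (orbitCount L m 1 d + (if 2 ∣ d then orbitCount L m (-1) (d / 2) else 0)) =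
      ∑ d ∈ i.divisors, d * (orbitCount L m (-1) d + (if d = 1 then 1 else 0)) := by
    intro i hi0 hi
    have : NeZero i := ⟨hi0⟩
    have h1 := two_mul_sum_orbitCount_odd (m := m) hi
    have h2 := sum_orbitCount (m := m) hi
    have h3 : ∑ d ∈ i.divisors, d * orbitCount L m (-1) d =
        (∑ d ∈ i.divisors, if Odd (i / d) then d * orbitCount L m (-1) d else 0) +
        ∑ d ∈ i.divisors, if Odd (i / d) then 0 else d * orbitCount L m (-1) d := by
      rw [← Finset.sum_add_distrib]
      refine Finset.sum_congr rfl fun d _ => ?_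
      split_ifs <;> simp
    have h4 : ∑ d ∈ i.divisors, d * (if 2 ∣ d then orbitCount L m (-1) (d / 2) else 0) =
        2 * ∑ d ∈ i.divisors, if Odd (i / d) then 0 else d * orbitCount L m (-1) d := by
      rw [Finset.mul_sum]
      simp only [mul_ite, mul_zero, ← ite_not (Odd _)]
      rw [← Finset.sum_filter, ← Finset.sum_filter]
      refine Finset.sum_bij' (fun d _ => d / 2) (fun d _ => 2 * d) ?_ ?_ ?_ ?_ ?_
      · intro d hd
        obtain ⟨hd, e, rfl⟩ := Finset.mem_filter.1 hd
        obtain ⟨c, rfl⟩ := Nat.dvd_of_mem_divisors hd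
        have he : 0 < e := Nat.pos_of_ne_zero (by rintro rfl; simp at hi0)
        rw [Nat.mul_div_cancel_left _ two_pos]
        refine Finset.mem_filter.2 ⟨Nat.mem_divisors.2 ⟨⟨2 * c, by ring⟩, hi0⟩, ?_⟩
        rw [show 2 * e * c = e * (2 * c) by ring, Nat.mul_div_cancel_left _ he]
        simp
      · intro d hd
        obtain ⟨hd, h⟩ := Finset.mem_filter.1 hd
        obtain ⟨c, rfl⟩ := Nat.dvd_of_mem_divisors hd
        have he : 0 < d := Nat.pos_of_ne_zero (by rintro rfl; simp at hi0)
        rw [Nat.mul_div_cancel_left _ he, Nat.not_odd_iff_even, even_iff_two_dvd] at h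
        exact Finset.mem_filter.2
          ⟨Nat.mem_divisors.2 ⟨by rw [mul_comm]; exact Nat.mul_dvd_mul_left d h, hi0⟩,
            dvd_mul_right _ _⟩
      · intro d hd
        exact Nat.mul_div_cancel' (Finset.mem_filter.1 hd).2
      · intro d _
        exact Nat.mul_div_cancel_left _ two_pos
      · intro d hd
        conv_lhs => rw [← Nat.mul_div_cancel' (Finset.mem_filter.1 hd).2]
        rw [Nat.mul_div_cancel_left _ two_pos, mul_assoc]
    have h5 : ∑ d ∈ i.divisors, d * (if d = 1 then 1 else 0) = 1 := by
      simp [Finset.sum_ite_eq', hi0]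
    simp only [mul_add, Finset.sum_add_distrib]
    rw [h4, h5]
    -- Let `A` and `B` be the parts of the negative sum with `i / d` odd and even, and `P` the
    -- positive sum. Then `P + A + B = 2 * A + 1`, so `P + 2 * B = A + B + 1`.
    omega
  have hpos := NeZero.ne i
  induction i using Nat.strong_induction_on with
  | _ i ih =>
    have := key i hpos hi
    rw [← Nat.cons_self_properDivisors hpos, Finset.sum_cons, Finset.sum_cons,
      Finset.sum_congr rfl (g := fun d => d * (orbitCount L m (-1) d + (if d = 1 then 1 else 0)))] at this
    · exact Nat.eq_of_mul_eq_mul_left (Nat.pos_of_ne_zero hpos) (Nat.add_right_cancel this)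
    · intro d hd
      obtain ⟨h1, h2⟩ := Nat.mem_properDivisors.1 hd
      have hd0 : d ≠ 0 := by rintro rfl; exact hpos (Nat.eq_zero_of_zero_dvd h1)
      have : NeZero d := ⟨hd0⟩
      rw [ih d h2 (h1.trans hi) hd0]

/-- Write `i = 2 ^ a * b` with `b` odd. Oddness of `i / d` forces `2 ^ a ∣ d`, so the count of
negative words is an ordinary divisor sum over `b`. In particular the value does not depend on `L`.
-/
theorem orbitCount_neg_one {i : ℕ} [NeZero i] (hi : i ∣ L) :
    (orbitCount L m (-1) i : ℚ) = cycleExponent i m := by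
  obtain ⟨a, b, hb, rfl⟩ := Nat.exists_eq_two_pow_mul_odd (NeZero.ne i)
  have hodd : ∀ d b : ℕ, d ∣ 2 ^ a * b → Odd d → d ∣ b := fun d b h hd =>
    Nat.Coprime.dvd_of_dvd_mul_left (Nat.Coprime.pow_right a hd.coprime_two_right) h
  have h2a : 0 < 2 ^ a := by positivity
  have hmain := (ArithmeticFunction.sum_eq_iff_sum_mul_moebius_eq_on (R := ℚ)
    (f := fun c => ((2 ^ a * c : ℕ) : ℚ) * orbitCount L m (-1) (2 ^ a * c))
    (g := fun c => ((2 * (m : ℚ) + 1) ^ (2 ^ a * c) - 1) / 2)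
    -- The inversion is restricted to a divisor-closed set on which the word count is available.
    {c | Odd c ∧ 2 ^ a * c ∣ L}
    (fun c d hcd hd => ⟨hd.1.of_dvd_nat hcd, (Nat.mul_dvd_mul_left _ hcd).trans hd.2⟩)).1 (by
      rintro c hc0 ⟨hc, hcL⟩
      have : NeZero (2 ^ a * c) := ⟨by positivity⟩
      have h := two_mul_sum_orbitCount_odd (m := m) hcL
      have h' : ∑ d ∈ (2 ^ a * c).divisors,
          (if Odd (2 ^ a * c / d) then d * orbitCount L m (-1) d else 0) =
          ∑ d ∈ c.divisors, 2 ^ a * d * orbitCount L m (-1) (2 ^ a * d) := by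
        rw [← Finset.sum_filter]
        symm
        refine Finset.sum_bij (fun d _ => 2 ^ a * d) ?_ ?_ ?_ fun _ _ => rfl
        · intro d hd
          have hd' := Nat.dvd_of_mem_divisors hd
          refine Finset.mem_filter.2 ⟨Nat.mem_divisors.2
            ⟨Nat.mul_dvd_mul_left _ hd', NeZero.ne _⟩, ?_⟩
          rw [Nat.mul_div_mul_left _ _ h2a]
          exact hc.of_dvd_nat (Nat.div_dvd_of_dvd hd')
        · intro d _ e _ h
          exact Nat.eq_of_mul_eq_mul_left h2a h
        · intro d hd
          obtain ⟨hd, ho⟩ := Finset.mem_filter.1 hd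
          have hd' := Nat.dvd_of_mem_divisors hd
          obtain ⟨e, he⟩ := hd'
          have hdpos : 0 < d := Nat.pos_of_mem_divisors hd
          rw [he, Nat.mul_div_cancel_left _ hdpos] at ho
          obtain ⟨f, rfl⟩ := hodd e c ⟨d, by rw [he, mul_comm]⟩ ho
          have hepos : 0 < e := ho.pos
          refine ⟨f, Nat.mem_divisors.2 ⟨dvd_mul_left _ _, hc0.ne'⟩, ?_⟩
          apply Nat.eq_of_mul_eq_mul_right hepos
          rw [← he]; ring
      rw [h'] at h
      have hq : (2 : ℚ) * (∑ d ∈ c.divisors,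
          ((2 ^ a * d : ℕ) : ℚ) * orbitCount L m (-1) (2 ^ a * d)) + 1 =
          (2 * (m : ℚ) + 1) ^ (2 ^ a * c) := by exact_mod_cast h
      linarith) b hb.pos ⟨hb, hi⟩
  have hdiv : (2 ^ a * b).divisors.filter (fun d => Odd d) = b.divisors := by
    ext d
    simp only [Finset.mem_filter, Nat.mem_divisors]
    constructor
    · rintro ⟨⟨h, -⟩, hd⟩; exact ⟨hodd d b h hd, hb.pos.ne'⟩
    · rintro ⟨h, -⟩; exact ⟨⟨h.mul_left _, NeZero.ne _⟩, hb.of_dvd_nat h⟩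
  have hne : ((2 ^ a * b : ℕ) : ℚ) ≠ 0 := by exact_mod_cast NeZero.ne (2 ^ a * b)
  rw [Nat.sum_divisorsAntidiagonal (fun x y => (ArithmeticFunction.moebius x : ℚ) *
    (((2 * (m : ℚ) + 1) ^ (2 ^ a * y) - 1) / 2))] at hmain
  rw [cycleExponent, hdiv, eq_comm, one_div, inv_mul_eq_iff_eq_mul₀ (mul_ne_zero two_ne_zero hne),
    mul_assoc, ← hmain, Finset.mul_sum]
  refine Finset.sum_congr rfl fun d hd => ?_
  rw [Nat.mul_div_assoc _ (Nat.dvd_of_mem_divisors hd)]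
  ring

end Counting

/-! ### The factors as power series -/

section Series

variable {R : Type*} [CommRing R]

/-- The reciprocal of `1 - z d * X ^ d`. -/
noncomputable def geomSeries (z : ℕ → R) (d : ℕ) : PowerSeries R :=
  PowerSeries.invOfUnit (1 - PowerSeries.monomial d (z d)) 1

theorem one_sub_mul_geomSeries (z : ℕ → R) {d : ℕ} (hd : 0 < d) :
    (1 - PowerSeries.monomial d (z d)) * geomSeries z d = 1 := by
  refine PowerSeries.mul_invOfUnit _ _ ?_
  rw [map_sub, map_one, ← PowerSeries.coeff_zero_eq_constantCoeff_apply,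
    PowerSeries.coeff_monomial, if_neg hd.ne]
  simp

/-- The generating series of the weights of an orbit of length `d` and sign `s` by multiplicity. -/
def orbitSeries (z : ℕ → R) (s : ℤ) (d : ℕ) : PowerSeries R :=
  PowerSeries.mk fun j => if d ∣ j then orbitWeight z s d (j / d) else 0

theorem coeff_mul_one_sub_monomial (φ : PowerSeries R) (e j : ℕ) (c : R) :
    PowerSeries.coeff j (φ * (1 - PowerSeries.monomial e c)) =
      PowerSeries.coeff j φ - if e ≤ j then PowerSeries.coeff (j - e) φ * c else 0 := by
  rw [mul_sub, mul_one, map_sub, PowerSeries.monomial_eq_C_mul_X_pow, ← mul_assoc,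
    PowerSeries.coeff_mul_X_pow', PowerSeries.coeff_mul_C]

theorem coeff_orbitSeries_mul (z : ℕ → R) (s : ℤ) {d : ℕ} (hd : 0 < d) (k : ℕ) :
    PowerSeries.coeff (d * k) (orbitSeries z s d) = orbitWeight z s d k := by
  rw [orbitSeries, PowerSeries.coeff_mk, if_pos (dvd_mul_right _ _), Nat.mul_div_cancel_left _ hd]

theorem coeff_orbitSeries_of_not_dvd (z : ℕ → R) (s : ℤ) {d j : ℕ} (h : ¬ d ∣ j) :
    PowerSeries.coeff j (orbitSeries z s d) = 0 := by
  rw [orbitSeries, PowerSeries.coeff_mk, if_neg h]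

theorem orbitSeries_one (z : ℕ → R) {d : ℕ} (hd : 0 < d) :
    orbitSeries z 1 d = geomSeries z d := by
  have h : orbitSeries z 1 d * (1 - PowerSeries.monomial d (z d)) = 1 := by
    ext j
    rw [coeff_mul_one_sub_monomial, PowerSeries.coeff_one]
    by_cases hj : d ∣ j
    · obtain ⟨k, rfl⟩ := hj
      rw [coeff_orbitSeries_mul z 1 hd]
      cases k with
      | zero => simp [orbitWeight, hd.ne']
      | succ k =>
        rw [if_pos (Nat.le_mul_of_pos_right d k.succ_pos), mul_add_one, Nat.add_sub_cancel,
          coeff_orbitSeries_mul z 1 hd, if_neg (by omega)]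
        simp [orbitWeight, pow_succ]
    · have hlow : (if d ≤ j then PowerSeries.coeff (j - d) (orbitSeries z 1 d) * z d else 0) = 0 := by
        split_ifs with hle
        · rw [coeff_orbitSeries_of_not_dvd z 1
            (fun h => hj ((Nat.dvd_sub_iff_left hle dvd_rfl).1 h)), zero_mul]
        · rfl
      rw [hlow, coeff_orbitSeries_of_not_dvd z 1 hj, sub_zero,
        if_neg (fun h : j = 0 => hj (h ▸ dvd_zero d))]
  calc orbitSeries z 1 d = orbitSeries z 1 d *
        ((1 - PowerSeries.monomial d (z d)) * geomSeries z d) := by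
        rw [one_sub_mul_geomSeries z hd, mul_one]
    _ = geomSeries z d := by rw [← mul_assoc, h, one_mul]

/-- Raising the multiplicity by 2 multiplies the weight by `z (2 * d)`; multiplicities 0 and 1 give
the numerator. -/
theorem orbitSeries_neg_one (z : ℕ → R) {d : ℕ} (hd : 0 < d) :
    orbitSeries z (-1) d =
      (1 + PowerSeries.monomial d (z d)) * geomSeries z (2 * d) := by
  have h : orbitSeries z (-1) d * (1 - PowerSeries.monomial (2 * d) (z (2 * d))) =
      1 + PowerSeries.monomial d (z d) := by
    ext j
    rw [coeff_mul_one_sub_monomial, map_add, PowerSeries.coeff_one, PowerSeries.coeff_monomial]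
    by_cases hj : d ∣ j
    · obtain ⟨k, rfl⟩ := hj
      rw [coeff_orbitSeries_mul z _ hd]
      match k with
      | 0 => simp [orbitWeight, hd.ne, hd.ne']
      | 1 => simp [orbitWeight, hd.ne', hd]
      | k + 2 =>
        have h1 : d * (k + 2) - 2 * d = d * k := by
          rw [mul_add, mul_comm d 2, Nat.add_sub_cancel]
        have h2 : 2 * d ≤ d * (k + 2) := by nlinarith
        rw [if_pos h2, h1, coeff_orbitSeries_mul z _ hd, if_neg (by omega), if_neg (by omega)]
        simp [orbitWeight, pow_succ, mul_assoc]
    · have hlow : (if 2 * d ≤ j then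
          PowerSeries.coeff (j - 2 * d) (orbitSeries z (-1) d) * z (2 * d) else 0) = 0 := by
        split_ifs with hle
        · rw [coeff_orbitSeries_of_not_dvd z _
            (fun h => hj ((Nat.dvd_sub_iff_left hle (dvd_mul_left _ _)).1 h)), zero_mul]
        · rfl
      rw [hlow, coeff_orbitSeries_of_not_dvd z _ hj, if_neg (fun h : j = 0 => hj (h ▸ dvd_zero d)),
        if_neg (fun h : j = d => hj (h ▸ dvd_rfl)), sub_zero, add_zero]
  calc orbitSeries z (-1) d = orbitSeries z (-1) d *
        ((1 - PowerSeries.monomial (2 * d) (z (2 * d))) * geomSeries z (2 * d)) := by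
        rw [one_sub_mul_geomSeries z (by omega), mul_one]
    _ = _ := by rw [← mul_assoc, h]

/-- Power series modulo `X ^ (n + 1)`. -/
noncomputable abbrev truncHom (R : Type*) [CommRing R] (n : ℕ) :
    PowerSeries R →+* PowerSeries R ⧸ Ideal.span {(PowerSeries.X ^ (n + 1) : PowerSeries R)} :=
  Ideal.Quotient.mk _

theorem coeff_eq_of_truncHom_eq {n : ℕ} {a b : PowerSeries R} (h : truncHom R n a = truncHom R n b) :
    PowerSeries.coeff n a = PowerSeries.coeff n b := by
  rw [truncHom, Ideal.Quotient.eq, Ideal.mem_span_singleton, PowerSeries.X_pow_dvd_iff] at h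
  have := h n (Nat.lt_succ_self n)
  rwa [map_sub, sub_eq_zero] at this

theorem truncHom_monomial {n d : ℕ} (h : n < d) (c : R) :
    truncHom R n (PowerSeries.monomial d c) = 0 := by
  rw [truncHom, Ideal.Quotient.eq_zero_iff_mem, Ideal.mem_span_singleton,
    PowerSeries.monomial_eq_C_mul_X_pow]
  exact (pow_dvd_pow _ h).mul_left _

theorem truncHom_geomSeries {n d : ℕ} (h : n < d) (z : ℕ → R) :
    truncHom R n (geomSeries z d) = 1 := by
  have := congrArg (truncHom R n) (one_sub_mul_geomSeries z (by omega : 0 < d))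
  rwa [map_mul, map_sub, truncHom_monomial h, map_one, sub_zero, one_mul] at this

/-- The factor `(1 + z d * X ^ d) / (1 - z d * X ^ d)`. -/
noncomputable def cycleFactor (z : ℕ → R) (d : ℕ) : PowerSeries R :=
  (1 + PowerSeries.monomial d (z d)) * geomSeries z d

theorem truncHom_cycleFactor {n d : ℕ} (h : n < d) (z : ℕ → R) :
    truncHom R n (cycleFactor z d) = 1 := by
  rw [cycleFactor, map_mul, map_add, truncHom_monomial h, truncHom_geomSeries h, map_one, add_zero,
    mul_one]

theorem X_pow_dvd_cycleFactor_sub_one (z : ℕ → R) {d : ℕ} (hd : 0 < d) :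
    PowerSeries.X ^ d ∣ cycleFactor z d - 1 := by
  have : cycleFactor z d - 1 = PowerSeries.X ^ d * (PowerSeries.C (2 * z d) * geomSeries z d) := by
    conv_lhs => rw [← one_sub_mul_geomSeries z hd]
    rw [cycleFactor, PowerSeries.monomial_eq_C_mul_X_pow, map_mul, map_ofNat]
    ring
  rw [this]
  exact dvd_mul_right _ _

/-- Denominators of negative orbits of length `d` join those of positive orbits of length `2 * d`,
and `orbitCount_one_add` gives their total number. Truncation discards the lengths above `n`, which
need not divide `L`. -/
theorem truncHom_prod_orbitSeries (z : ℕ → R) {n m L : ℕ} [NeZero L]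
    (hdL : ∀ d ∈ Finset.Icc 1 n, d ∣ L) {f : ℕ → ℕ}
    (hf : ∀ d ∈ Finset.Icc 1 n, f d = orbitCount L m (-1) d) :
    truncHom R n (∏ ν : WordOrbit L m, orbitSeries z (orbitSign ν) (orbitLen ν)) =
      truncHom R n (geomSeries z 1 * ∏ d ∈ Finset.Icc 1 n, cycleFactor z d ^ f d) := by
  classical
  set q := truncHom R n
  have hser : ∀ ν : WordOrbit L m, q (orbitSeries z (orbitSign ν) (orbitLen ν)) =
      (if orbitSign ν = 1 then q (geomSeries z (orbitLen ν)) else 1) *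
      (if orbitSign ν = -1 then q ((1 + PowerSeries.monomial (orbitLen ν) (z (orbitLen ν))) *
        geomSeries z (2 * orbitLen ν)) else 1) := by
    intro ν
    rcases orbitSign_eq ν with h | h
    · rw [h, orbitSeries_one z (orbitLen_pos ν)]; simp
    · rw [h, orbitSeries_neg_one z (orbitLen_pos ν)]; simp
  have hgroup : ∀ (s : ℤ) (F : ℕ → PowerSeries R ⧸ Ideal.span
      {(PowerSeries.X ^ (n + 1) : PowerSeries R)}), (∀ d, n < d → F d = 1) →
      ∏ ν : WordOrbit L m, (if orbitSign ν = s then F (orbitLen ν) else 1) =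
      ∏ d ∈ Finset.Icc 1 n, F d ^ orbitCount L m s d := by
    intro s F hF
    rw [← Finset.prod_filter]
    symm
    rw [← Finset.prod_filter_mul_prod_filter_not (Finset.univ.filter fun ν : WordOrbit L m =>
      orbitSign ν = s) (fun ν => orbitLen ν ∈ Finset.Icc 1 n),
      Finset.prod_eq_one (s := Finset.filter (fun ν => ¬ orbitLen ν ∈ Finset.Icc 1 n) _), mul_one,
      ← Finset.prod_fiberwise_of_maps_to (g := orbitLen) (t := Finset.Icc 1 n)
        (fun ν hν => (Finset.mem_filter.1 hν).2)]
    · refine Finset.prod_congr rfl fun d hd => ?_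
      rw [Finset.prod_congr rfl (g := fun _ => F d)
        (fun ν hν => by rw [(Finset.mem_filter.1 hν).2]), Finset.prod_const, orbitCount]
      congr 2
      ext ν
      simp only [Finset.mem_filter, Finset.mem_univ, true_and]
      constructor
      · rintro ⟨rfl, h⟩; exact ⟨⟨h, hd⟩, rfl⟩
      · rintro ⟨⟨h, -⟩, h'⟩; exact ⟨h', h⟩
    · intro ν hν
      have h1 := (Finset.mem_filter.1 hν).2
      have h2 := orbitLen_pos ν
      rw [Finset.mem_Icc] at h1
      exact hF _ (by omega)
  -- Reindexing by `2 * d`; factors with `2 * d > n` truncate to `1`.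
  have hdouble : ∏ d ∈ Finset.Icc 1 n, q (geomSeries z (2 * d)) ^ orbitCount L m (-1) d =
      ∏ d ∈ Finset.Icc 1 n, q (geomSeries z d) ^
        (if 2 ∣ d then orbitCount L m (-1) (d / 2) else 0) := by
    rw [← Finset.prod_filter_mul_prod_filter_not (Finset.Icc 1 n) (fun d => 2 * d ≤ n),
      Finset.prod_eq_one (s := Finset.filter (fun d => ¬ 2 * d ≤ n) _), mul_one,
      ← Finset.prod_filter_mul_prod_filter_not (Finset.Icc 1 n) (fun d => 2 ∣ d),
      Finset.prod_eq_one (s := Finset.filter (fun d => ¬ 2 ∣ d) _), mul_one]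
    · refine Finset.prod_bij' (fun d _ => 2 * d) (fun d _ => d / 2) ?_ ?_ ?_ ?_ ?_
      · intro d hd
        simp only [Finset.mem_filter, Finset.mem_Icc] at hd ⊢
        omega
      · intro d hd
        simp only [Finset.mem_filter, Finset.mem_Icc] at hd ⊢
        omega
      · intro d _
        exact Nat.mul_div_cancel_left _ two_pos
      · intro d hd
        exact Nat.mul_div_cancel' (Finset.mem_filter.1 hd).2
      · intro d _
        rw [if_pos (dvd_mul_right _ _), Nat.mul_div_cancel_left _ two_pos]
    · intro d hd
      rw [if_neg (Finset.mem_filter.1 hd).2, pow_zero]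
    · intro d hd
      rw [truncHom_geomSeries (not_le.1 (Finset.mem_filter.1 hd).2), one_pow]
  have hone : q (geomSeries z 1) =
      ∏ d ∈ Finset.Icc 1 n, q (geomSeries z d) ^ (if d = 1 then 1 else 0) := by
    by_cases hn : 1 ≤ n
    · rw [Finset.prod_eq_single 1]
      · simp
      · intro d _ hd; simp [hd]
      · intro h; exact absurd (Finset.mem_Icc.2 ⟨le_rfl, hn⟩) h
    · rw [truncHom_geomSeries (by omega), Finset.Icc_eq_empty hn, Finset.prod_empty]
  rw [map_prod, Finset.prod_congr rfl fun ν _ => hser ν, Finset.prod_mul_distrib,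
    hgroup 1 (fun d => q (geomSeries z d)) (fun d hd => truncHom_geomSeries hd z),
    hgroup (-1) (fun d => q ((1 + PowerSeries.monomial d (z d)) * geomSeries z (2 * d)))
      (fun d hd => by
        rw [map_mul, map_add, truncHom_monomial hd, truncHom_geomSeries (by omega), map_one,
          add_zero, mul_one])]
  simp only [map_mul, mul_pow, Finset.prod_mul_distrib]
  rw [hdouble, mul_left_comm, ← Finset.prod_mul_distrib, map_prod, hone]
  simp only [← pow_add]
  rw [← Finset.prod_mul_distrib, ← Finset.prod_mul_distrib]
  refine Finset.prod_congr rfl fun d hd => ?_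
  have : NeZero d := ⟨by have := (Finset.mem_Icc.1 hd).1; omega⟩
  rw [orbitCount_one_add (hdL d hd), hf d hd, cycleFactor, map_pow, map_mul, mul_pow,
    pow_add (q (geomSeries z d))]
  ring

end Series

/-! ### The cycle generating function -/

theorem sum_mul_numCycles {n : ℕ} (π : Equiv.Perm (Fin n)) :
    ∑ i ∈ Finset.Icc 1 n, i * numCycles i π = n := by
  rw [Finset.sum_congr rfl fun i hi => mul_numCycles π (Finset.mem_Icc.1 hi).1,
    ← Finset.card_eq_sum_card_fiberwise, Finset.card_univ, Fintype.card_fin]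
  intro p _
  have hpos : 0 < Function.minimalPeriod π p :=
    Function.minimalPeriod_pos_of_mem_periodicPts (π.injective.mem_periodicPts p)
  classical
  refine Finset.mem_coe.2 (Finset.mem_Icc.2 ⟨hpos, ?_⟩)
  rw [← card_permOrbitMk_eq]
  exact (Finset.card_le_univ _).trans_eq (Fintype.card_fin n)

/-- The scaled indeterminate `z_i / (2m+1)^i`. -/
noncomputable def scaledVar (m i : ℕ) : MvPolynomial ℕ ℚ :=
  MvPolynomial.C (1 / (2 * (m : ℚ) + 1) ^ i) * MvPolynomial.X i

/-- Cycle lengths add up to `n`, so scaling the indeterminates produces the probability weight of a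
placement sequence. -/
theorem prod_scaledVar (m : ℕ) {n : ℕ} (π : Equiv.Perm (Fin n)) :
    ∏ i ∈ Finset.Icc 1 n, scaledVar m i ^ numCycles i π =
      MvPolynomial.C (1 / (2 * (m : ℚ) + 1) ^ n) *
        ∏ i ∈ Finset.Icc 1 n, MvPolynomial.X i ^ numCycles i π := by
  simp only [scaledVar, mul_pow, Finset.prod_mul_distrib]
  congr 1
  simp only [← map_pow, ← map_prod, one_div, ← inv_pow, ← pow_mul]
  rw [Finset.prod_pow_eq_pow_sum, sum_mul_numCycles]

theorem coeff_lazyCycleGF_eq_sum (m n : ℕ) :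
    PowerSeries.coeff n (lazyCycleGF m) =
      ∑ π : Equiv.Perm (Fin n), ∑ w : Fin n → ShelfPlacement m,
        (if lazyDeck w = List.ofFn π then
          ∏ i ∈ Finset.Icc 1 n, scaledVar m i ^ numCycles i π else 0) := by
  have h : PowerSeries.coeff n (lazyCycleGF m) = ∑ π : Equiv.Perm (Fin n),
      MvPolynomial.C (lazyShelfProb m π) *
        ∏ i ∈ Finset.Icc 1 n, MvPolynomial.X i ^ numCycles i π := by
    rw [lazyCycleGF, PowerSeries.coeff_mk]
    split_ifs with hn
    · subst hn
      -- The empty deck has one shuffle, so the constant term `1` fits the general formula.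
      simp [lazyShelfProb, lazyDeck, lazyShelves]
    · rfl
  rw [h]
  refine Finset.sum_congr rfl fun π _ => ?_
  rw [← Finset.sum_filter, Finset.sum_const, prod_scaledVar, lazyShelfProb, nsmul_eq_mul,
    ← mul_assoc, div_eq_mul_one_div, map_mul, map_natCast]

/-- The length `n!` serves twice: it is a multiple of every `d ≤ n`, and by Lagrange it annihilates
every permutation. -/
theorem coeff_lazyCycleGF {m n L : ℕ} [NeZero L] (hL : n.factorial = L) {f : ℕ → ℕ}
    (hf : ∀ d ∈ Finset.Icc 1 n, f d = orbitCount L m (-1) d) :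
    PowerSeries.coeff n (lazyCycleGF m) = PowerSeries.coeff n (geomSeries (scaledVar m) 1 *
      ∏ d ∈ Finset.Icc 1 n, cycleFactor (scaledVar m) d ^ f d) := by
  have hdL : ∀ d ∈ Finset.Icc 1 n, d ∣ L := fun d hd =>
    hL ▸ Nat.dvd_factorial (Finset.mem_Icc.1 hd).1 (Finset.mem_Icc.1 hd).2
  rw [← coeff_eq_of_truncHom_eq (truncHom_prod_orbitSeries (scaledVar m) hdL hf),
    PowerSeries.coeff_prod, coeff_lazyCycleGF_eq_sum, sum_shuffles_eq (L := L)]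
  · simp only [orbitSeries, PowerSeries.coeff_mk]
  · intro π
    have := pow_card_eq_one (x := π)
    rwa [Fintype.card_perm, Fintype.card_fin, hL] at this

open scoped PowerSeries.WithPiTopology in
-- The `i`-th factor is `1` modulo `X ^ i`, so the orders of the deviations from `1` tend to
-- infinity.
theorem multipliable_cycleFactor_pow {R : Type*} [CommRing R] [TopologicalSpace R] (z : ℕ → R)
    (f : ℕ+ → ℕ) : Multipliable fun i : ℕ+ => cycleFactor z i ^ f i := by
  have := PowerSeries.WithPiTopology.multipliable_one_add_of_tendsto_order_atTop_nhds_top R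
    (f := fun i : ℕ+ => cycleFactor z i ^ f i - 1) ?_
  · simpa using this
  · refine ENat.tendsto_nhds_top_iff_natCast_lt.mpr fun n => Filter.eventually_atTop.mpr
      ⟨n.succPNat, fun i hi => ?_⟩
    have hi' : n < (i : ℕ) := hi
    refine lt_of_lt_of_le (Nat.cast_lt.2 hi') (PowerSeries.le_order _ _ fun j hj => ?_)
    exact PowerSeries.X_pow_dvd_iff.1 ((X_pow_dvd_cycleFactor_sub_one z i.pos).trans
      (sub_one_dvd_pow_sub_one _ _)) j (Nat.cast_lt.1 hj)

theorem truncHom_prod_pnat {R : Type*} [CommRing R] (z : ℕ → R) (f : ℕ → ℕ) {n : ℕ}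
    {s : Finset ℕ+} (hs : ∀ i : ℕ+, (i : ℕ) ≤ n → i ∈ s) :
    truncHom R n (∏ i ∈ s, cycleFactor z i ^ f i) =
      truncHom R n (∏ d ∈ Finset.Icc 1 n, cycleFactor z d ^ f d) := by
  have hmap := Finset.prod_map s ⟨((↑) : ℕ+ → ℕ), PNat.coe_injective⟩
    (fun d => cycleFactor z d ^ f d)
  simp only [Function.Embedding.coeFn_mk] at hmap
  rw [← hmap, map_prod, map_prod]
  symm
  refine Finset.prod_subset ?_ ?_
  · intro d hd
    obtain ⟨h1, h2⟩ := Finset.mem_Icc.1 hd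
    exact Finset.mem_map.2 ⟨⟨d, h1⟩, hs _ h2, rfl⟩
  · intro d hd hd'
    obtain ⟨i, -, rfl⟩ := Finset.mem_map.1 hd
    have : n < (i : ℕ) := by
      by_contra h
      exact hd' (Finset.mem_Icc.2 ⟨i.pos, not_lt.1 h⟩)
    rw [map_pow]
    exact (congrArg (· ^ _) (truncHom_cycleFactor this z)).trans (one_pow _)

open scoped PowerSeries.WithPiTopology in
theorem theorem5p1 (m : ℕ) (hm : 0 < m)
    [TopologicalSpace (MvPolynomial ℕ ℚ)] [DiscreteTopology (MvPolynomial ℕ ℚ)] :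
    ∃ f : ℕ+ → ℕ,
      (∀ i : ℕ+, (f i : ℚ) = cycleExponent i m) ∧
      Multipliable (fun i : ℕ+ => ((1 + cycleTerm m i) * cycleGeom m i) ^ f i) ∧
      lazyCycleGF m =
        cycleGeom m 1 * ∏' i : ℕ+, ((1 + cycleTerm m i) * cycleGeom m i) ^ f i := by
  -- The exponent counts negative primitive necklaces, with word length `i` itself so that it does
  -- not depend on `n`.
  let g : ℕ → ℕ := fun i => if h : i = 0 then 0 else @orbitCount i m ⟨h⟩ (-1) i
  have hg : ∀ i : ℕ, i ≠ 0 → (g i : ℚ) = cycleExponent i m := fun i hi => by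
    have : NeZero i := ⟨hi⟩
    simp only [g, dif_neg hi]
    exact orbitCount_neg_one dvd_rfl
  have hmul := multipliable_cycleFactor_pow (scaledVar m) (fun i => g i)
  refine ⟨fun i => g i, fun i => hg i i.ne_zero, hmul, ?_⟩
  change _ = geomSeries (scaledVar m) 1 * ∏' i : ℕ+, cycleFactor (scaledVar m) i ^ g i
  ext1 n
  have hcont : Continuous fun φ : PowerSeries (MvPolynomial ℕ ℚ) =>
      PowerSeries.coeff n (geomSeries (scaledVar m) 1 * φ) := by
    simp only [PowerSeries.coeff_mul]
    exact continuous_finsetSum _ fun p _ =>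
      continuous_of_discreteTopology.comp (PowerSeries.WithPiTopology.continuous_coeff _ p.2)
  -- Coefficients are discrete, so the `n`-th coefficient of the finite partial products is
  -- eventually constant; a finite set `s` containing `1, …, n` attains it.
  have hlim := (hcont.tendsto _).comp hmul.hasProd
  rw [nhds_discrete, Filter.tendsto_pure] at hlim
  obtain ⟨s, hs, hs'⟩ := (hlim.and (Filter.eventually_ge_atTop
    ((Finset.Icc 1 n.succPNat : Finset ℕ+)))).exists
  rw [← hs]
  have : NeZero n.factorial := ⟨n.factorial_ne_zero⟩
  rw [coeff_lazyCycleGF rfl (f := g)]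
  · refine (coeff_eq_of_truncHom_eq ?_).symm
    rw [map_mul, map_mul, truncHom_prod_pnat]
    intro i hi
    refine hs' (Finset.mem_Icc.2 ⟨one_le, ?_⟩)
    rw [← PNat.coe_le_coe, Nat.succPNat_coe]
    omega
  · intro d hd
    obtain ⟨h1, h2⟩ := Finset.mem_Icc.1 hd
    have : NeZero d := ⟨by omega⟩
    have h := hg d (by omega)
    -- The counts for word lengths `d` and `n!` agree, both being `cycleExponent d m`.
    rw [← orbitCount_neg_one (Nat.dvd_factorial h1 h2)] at h
    exact_mod_cast h
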